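/- Let $\gamma_h$ denote the density of the centered Gaussian on $\mathbb{R}^d$ with covariance $hI_d$. For probability measures $\mu,\nu$ and $q>1$ let $\mathcal{R}_q(\mu\,\|\,\nu)=\frac{1}{q-1}\log\int\big(\frac{d\mu}{d\nu}\big)^q\,d\nu\in[0,\infty]$ be the $q$-Rényi divergence ($+\infty$ if $\mu\not\ll\nu$). Let $\pi$ be a probability measure on $\mathbb{R}^d$ with a density with respect to Lebesgue measure that satisfies a logarithmic Sobolev inequality: for some finite $C\ge 0$, $$\int f^2\log f^2\,d\pi-\int f^2\,d\pi\,\log\int f^2\,d\pi\le 2C\int|\nabla f|^2\,d\pi\quad\text{for all locally Lipschitz } f\in L^2(\pi),$$ and let $C_{\mathsf{LSI}}(\pi)$ be the smallest such $C$. Let $\pi_0$ be any probability measure on $\mathbb{R}^d$ and let $\pi_k$ be the law of the $k$-th iterate $x_k$ of the proximal sampler with target $\pi$ and step size $h>0$: $x_0\sim\pi_0$; given $x_k$, draw $y_{k+1}\sim\mathcal{N}(x_k,hI_d)$, and then $x_{k+1}$ from the probability measure proportional to $\gamma_h(x-y_{k+1})\,\pi(dx)$. There is a universal constant $c>0$ (in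 particular independent of $d,\pi,\pi_0,h,p,q,q_0,\varepsilon$) such that, for all $d$, $\pi$, $\pi_0$, $h$ as above, with $T:=\max\{1,\,h^{-1}C_{\mathsf{LSI}}(\pi)\}$ (so $T=h^{-1}C_{\mathsf{LSI}}(\pi)$ whenever $h\le C_{\mathsf{LSI}}(\pi)$), the following hold. (1) For all $1<p<q$ there is an integer $0\le N\le\big\lceil c\,T\log_2\frac{q-1}{p-1}\big\rceil$ such that $\mathcal{R}_q(\pi_n\,\|\,\pi)\le\mathcal{R}_p(\pi_0\,\|\,\pi)$ for all $n\ge N$. (2) For all $\varepsilon>0$ and $q_0,q>1$ such that $\bar q:=\min\{2,q_0\}$ satisfies $\mathcal{R}_{\bar q}(\pi_0\,\|\,\pi)<\infty$, there is an integer $$0\le N\le\Big\lceil c\,T\log\frac{q\,\max\{1,\ \mathcal{R}_{\bar q}(\pi_0\,\|\,\pi)/\varepsilon\}}{\bar q-1}\Big\rceil$$ such that $\mathcal{R}_q(\pi_n\,\|\,\pi)\le\varepsilon$ for all $n\ge N$. -/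

import Mathlib

open MeasureTheory ProbabilityTheory
open scoped ENNReal

noncomputable section

/-- Density `(2πh)^{-d/2} exp(-‖z‖² / (2h))` of the centered Gaussian `γ_h` on `ℝ^d` with
covariance `h I_d`. -/
def gaussianDensity {d : ℕ} (h : ℝ) (z : EuclideanSpace ℝ (Fin d)) : ℝ≥0∞ :=
  ENNReal.ofReal ((2 * Real.pi * h) ^ (-(d : ℝ) / 2) * Real.exp (-‖z‖ ^ 2 / (2 * h)))

@[fun_prop]
theorem measurable_gaussianDensity {d : ℕ} (h : ℝ) :
    Measurable (gaussianDensity h : EuclideanSpace ℝ (Fin d) → ℝ≥0∞) := by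
  unfold gaussianDensity
  fun_prop

/-- Forward step: the kernel `x ↦ N(x, h I_d)`. -/
def proxForward {d : ℕ} (h : ℝ) :
    Kernel (EuclideanSpace ℝ (Fin d)) (EuclideanSpace ℝ (Fin d)) :=
  Kernel.withDensity (Kernel.const _ volume) (fun x y => gaussianDensity h (y - x))

/-- Normalizing constant `∫ γ_h(x - y) π(dx)` of the backward step. -/
def proxNormalizer {d : ℕ} (π : Measure (EuclideanSpace ℝ (Fin d))) (h : ℝ)
    (y : EuclideanSpace ℝ (Fin d)) : ℝ≥0∞ :=
  ∫⁻ x, gaussianDensity h (x - y) ∂π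

/-- Backward step: the kernel `y ↦ π^{X|Y=y}`, the probability measure proportional to
`γ_h(x - y) π(dx)`. -/
def proxBackward {d : ℕ} (π : Measure (EuclideanSpace ℝ (Fin d))) [SFinite π] (h : ℝ) :
    Kernel (EuclideanSpace ℝ (Fin d)) (EuclideanSpace ℝ (Fin d)) :=
  Kernel.withDensity (Kernel.const _ π)
    (fun y x => gaussianDensity h (x - y) / proxNormalizer π h y)

/-- Law of the `k`-th iterate of the proximal sampler with target `π`, step size `h` and initial
law `π₀`: each iteration applies the forward and then the backward kernel. -/
def proxLaw {d : ℕ} (π : Measure (EuclideanSpace ℝ (Fin d))) [SFinite π] (h : ℝ)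
    (π₀ : Measure (EuclideanSpace ℝ (Fin d))) : ℕ → Measure (EuclideanSpace ℝ (Fin d))
  | 0 => π₀
  | k + 1 => ((proxLaw π h π₀ k).bind (proxForward h)).bind (proxBackward π h)

open Classical in
/-- The `q`-Rényi divergence `R_q(μ‖ν) = (q - 1)⁻¹ log ∫ (dμ/dν)^q dν` (for `q > 1`), with value
`+∞` when `μ` is not absolutely continuous with respect to `ν` or the integral diverges. -/
def renyiDiv {α : Type*} [MeasurableSpace α] (q : ℝ) (μ ν : Measure α) : EReal :=
  if μ ≪ ν then (((q - 1)⁻¹ : ℝ) : EReal) * ENNReal.log (∫⁻ x, (μ.rnDeriv ν x) ^ q ∂ν) else ⊤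

/-- Logarithmic Sobolev inequality with constant `C`: `Ent_π(f²) ≤ 2 C ∫ |∇f|² dπ` for all locally
Lipschitz `f ∈ L²(π)`. If `∇f ∉ L²(π)` the right-hand side is `+∞` and nothing is required;
otherwise the entropy has to be finite (`f² log f²` integrable) and the inequality holds. -/
def SatisfiesLSI {d : ℕ} (π : Measure (EuclideanSpace ℝ (Fin d))) (C : ℝ) : Prop :=
  ∀ f : EuclideanSpace ℝ (Fin d) → ℝ, LocallyLipschitz f → MemLp f 2 π →
    MemLp (fun x => fderiv ℝ f x) 2 π →
      Integrable (fun x => f x ^ 2 * Real.log (f x ^ 2)) π ∧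
      (∫ x, f x ^ 2 * Real.log (f x ^ 2) ∂π) - (∫ x, f x ^ 2 ∂π) * Real.log (∫ x, f x ^ 2 ∂π)
        ≤ 2 * C * ∫ x, ‖fderiv ℝ f x‖ ^ 2 ∂π

/-- The log-Sobolev constant: the smallest `C ≥ 0` for which the inequality holds (meaningful when
there is one). -/
def logSobolevConst {d : ℕ} (π : Measure (EuclideanSpace ℝ (Fin d))) : ℝ :=
  sInf {C : ℝ | 0 ≤ C ∧ SatisfiesLSI π C}

end

/-!
Write `H g (x) = ∫ g dN(x, h I)` for the forward step acting on functions and `Q f (y)` for the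
average of `f` over the backward kernel at `y`. If `x_k` has density `f` relative to `π`, then
`x_{k+1}` has density `H (Q f)`. The map `Q` is a contraction from `L^a(π)` to `L^a(π * γ_h)` by
Jensen's inequality, so everything rests on the hypercontractivity of `H`: if `π` satisfies a
logarithmic Sobolev inequality with constant `h / κ`, then `H` maps `L^a(π * γ_h)` to `L^b(π)` with
norm at most one, where `b - 1 = (1 + κ) (a - 1)` (`lintegral_rpow_lintegral_proxForward_le`).

For this, let `v_θ = θ⁻¹ log H (g ^ θ)` be the logarithm of the power mean of order `θ`, so that
`exp v_1 = H g`, while `exp (a v_a) = H (g ^ a)` has `π`-integral `∫ g ^ a d(π * γ_h)`. The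
derivative `∂v/∂θ` is a Gaussian entropy, and the reverse logarithmic Sobolev inequality of the
Gaussian kernel, a consequence of the Gibbs variational principle for linear functions
(`sq_integral_mul_inner_le`), gives `∂v/∂θ ≥ (h / 2) |∇v|²`. With `b(θ) = a + κ (a - θ)`, the
logarithmic Sobolev inequality of `π` applied to `exp (b(θ) v_θ / 2)` shows precisely that
`‖exp v_θ‖_{L^{b(θ)}(π)}` is nondecreasing on `[1, a]`
(`log_integral_exp_logPowerMean_le`). Thus the target is the only measure whose logarithmic Sobolev
inequality is needed; no such inequality is used along the heat flow.

Since `R_q = q / (q - 1) * log ‖f‖_q`, one iteration multiplies `q - 1` by `1 + κ` and the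
divergence by a factor at most `1`; for `q ≤ 2` and `κ ≤ 1` this factor is even at most `1 - κ / 4`
(`renyiDiv_proxStep_le`, `renyiDiv_proxLaw_le_geometric`). Taking `κ = 1 / T`, part (1) counts the
iterations that bring the order from `p` to `q`. For part (2), the order increases to `2` and the
divergence decays at the same time, and for `q > 2` some further iterations raise the order to `q`.
-/

open scoped RealInnerProductSpace

/-! ### The Gaussian kernel -/

section GaussianKernel

variable {d : ℕ} {h : ℝ}

theorem gaussianDensity_neg (h : ℝ) (z : EuclideanSpace ℝ (Fin d)) :
    gaussianDensity h (-z) = gaussianDensity h z := by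
  simp [gaussianDensity]

theorem gaussianDensity_sub_comm (h : ℝ) (x y : EuclideanSpace ℝ (Fin d)) :
    gaussianDensity h (x - y) = gaussianDensity h (y - x) := by
  rw [← gaussianDensity_neg, neg_sub]

theorem gaussianDensity_pos (hh : 0 < h) (z : EuclideanSpace ℝ (Fin d)) :
    0 < gaussianDensity h z := by
  unfold gaussianDensity
  rw [ENNReal.ofReal_pos]
  positivity

theorem gaussianDensity_le (hh : 0 < h) (z : EuclideanSpace ℝ (Fin d)) :
    gaussianDensity h z ≤ ENNReal.ofReal ((2 * Real.pi * h) ^ (-(d : ℝ) / 2)) := by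
  unfold gaussianDensity
  refine ENNReal.ofReal_le_ofReal (mul_le_of_le_one_right (by positivity) ?_)
  rw [Real.exp_le_one_iff]
  exact div_nonpos_of_nonpos_of_nonneg (neg_nonpos.2 (sq_nonneg _)) (by positivity)

theorem lintegral_gaussianDensity (hh : 0 < h) :
    ∫⁻ z : EuclideanSpace ℝ (Fin d), gaussianDensity h z = 1 := by
  have hb : 0 < 1 / (2 * h) := by positivity
  have h1 := GaussianFourier.integral_rexp_neg_mul_sq_norm
    (V := EuclideanSpace ℝ (Fin d)) hb
  have hpos : (0 : ℝ) < (Real.pi / (1 / (2 * h))) ^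
      ((Module.finrank ℝ (EuclideanSpace ℝ (Fin d)) : ℝ) / 2) := by positivity
  have hint : Integrable
      (fun v : EuclideanSpace ℝ (Fin d) => Real.exp (-(1 / (2 * h)) * ‖v‖ ^ 2)) := by
    by_contra hni
    rw [integral_undef hni] at h1
    exact hpos.ne h1
  have h2 : ∀ z : EuclideanSpace ℝ (Fin d), gaussianDensity h z
      = ENNReal.ofReal ((2 * Real.pi * h) ^ (-(d : ℝ) / 2) *
        Real.exp (-(1 / (2 * h)) * ‖z‖ ^ 2)) := by
    intro z
    unfold gaussianDensity
    congr 3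
    ring
  simp_rw [h2]
  rw [← ofReal_integral_eq_lintegral_ofReal (hint.const_mul _)
    (Filter.Eventually.of_forall fun z => by positivity), integral_const_mul, h1,
    finrank_euclideanSpace_fin]
  have h3 : Real.pi / (1 / (2 * h)) = 2 * Real.pi * h := by field_simp
  rw [h3, ← Real.rpow_add (by positivity)]
  rw [show -(d : ℝ) / 2 + d / 2 = 0 by ring, Real.rpow_zero, ENNReal.ofReal_one]

theorem proxForward_apply (h : ℝ) (x : EuclideanSpace ℝ (Fin d)) :
    proxForward h x = volume.withDensity (fun y => gaussianDensity h (y - x)) := by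
  unfold proxForward
  rw [Kernel.withDensity_apply _ (by fun_prop), Kernel.const_apply]

theorem lintegral_proxForward (h : ℝ) (x : EuclideanSpace ℝ (Fin d))
    {g : EuclideanSpace ℝ (Fin d) → ℝ≥0∞} (hg : Measurable g) :
    ∫⁻ y, g y ∂proxForward h x = ∫⁻ y, gaussianDensity h (y - x) * g y := by
  rw [proxForward_apply, lintegral_withDensity_eq_lintegral_mul _ (by fun_prop) hg]
  rfl

theorem isMarkovKernel_proxForward (d : ℕ) (hh : 0 < h) :
    IsMarkovKernel (proxForward h : Kernel (EuclideanSpace ℝ (Fin d)) _) := by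
  refine ⟨fun x => ⟨?_⟩⟩
  rw [proxForward_apply, withDensity_apply _ MeasurableSet.univ, Measure.restrict_univ,
    lintegral_sub_right_eq_self (fun y => gaussianDensity h y), lintegral_gaussianDensity hh]

/-- Translating a Gaussian is an exponential tilt (Cameron–Martin). -/
theorem gaussianDensity_sub (hh : 0 < h) (z v : EuclideanSpace ℝ (Fin d)) :
    gaussianDensity h (z - v)
      = gaussianDensity h z * ENNReal.ofReal (Real.exp (⟪v, z⟫ / h - ‖v‖ ^ 2 / (2 * h))) := by
  unfold gaussianDensity
  rw [← ENNReal.ofReal_mul (by positivity), mul_assoc ((2 * Real.pi * h) ^ (-(d : ℝ) / 2)),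
    ← Real.exp_add]
  congr 3
  rw [norm_sub_sq_real, real_inner_comm]
  field_simp
  ring

theorem proxForward_add (hh : 0 < h) (x v : EuclideanSpace ℝ (Fin d)) :
    proxForward h (x + v) = (proxForward h x).withDensity
      (fun y => ENNReal.ofReal (Real.exp (⟪v, y - x⟫ / h - ‖v‖ ^ 2 / (2 * h)))) := by
  rw [proxForward_apply, proxForward_apply, ← withDensity_mul _ (by fun_prop) (by fun_prop)]
  congr 1
  ext y
  rw [← sub_sub, gaussianDensity_sub hh]
  rfl

theorem integrable_proxForward_add_iff (hh : 0 < h) (x v : EuclideanSpace ℝ (Fin d))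
    (g : EuclideanSpace ℝ (Fin d) → ℝ) :
    Integrable g (proxForward h (x + v)) ↔
      Integrable (fun y => Real.exp (⟪v, y - x⟫ / h) * g y) (proxForward h x) := by
  rw [proxForward_add hh, integrable_withDensity_iff_integrable_smul' (by fun_prop)
    (by simp)]
  have h1 : (fun y => (ENNReal.ofReal (Real.exp
      (⟪v, y - x⟫ / h - ‖v‖ ^ 2 / (2 * h)))).toReal • g y)
      = fun y => Real.exp (-(‖v‖ ^ 2 / (2 * h))) * (Real.exp (⟪v, y - x⟫ / h) * g y) := by
    ext y
    rw [ENNReal.toReal_ofReal (Real.exp_pos _).le, smul_eq_mul, sub_eq_neg_add, Real.exp_add,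
      mul_assoc]
  rw [h1, integrable_const_mul_iff (Real.exp_pos _).ne'.isUnit]

theorem integral_proxForward_add (hh : 0 < h) (x v : EuclideanSpace ℝ (Fin d))
    (g : EuclideanSpace ℝ (Fin d) → ℝ) :
    ∫ y, g y ∂proxForward h (x + v)
      = Real.exp (-(‖v‖ ^ 2 / (2 * h))) *
        ∫ y, Real.exp (⟪v, y - x⟫ / h) * g y ∂proxForward h x := by
  rw [proxForward_add hh, integral_withDensity_eq_integral_toReal_smul (by fun_prop)
    (by simp), ← integral_const_mul]
  congr 1
  ext y
  rw [ENNReal.toReal_ofReal (Real.exp_pos _).le, smul_eq_mul, sub_eq_neg_add, Real.exp_add,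
    mul_assoc]

theorem integrable_exp_inner_proxForward (hh : 0 < h) (x v : EuclideanSpace ℝ (Fin d)) :
    Integrable (fun y => Real.exp (⟪v, y - x⟫ / h)) (proxForward h x) := by
  have := isMarkovKernel_proxForward d hh
  have h1 := (integrable_proxForward_add_iff hh x v (fun _ => 1)).1 (integrable_const _)
  simpa using h1

theorem integral_exp_inner_proxForward (hh : 0 < h) (x v : EuclideanSpace ℝ (Fin d)) :
    ∫ y, Real.exp (⟪v, y - x⟫ / h) ∂proxForward h x = Real.exp (‖v‖ ^ 2 / (2 * h)) := by
  have := isMarkovKernel_proxForward d hh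
  have h1 := integral_proxForward_add hh x v (fun _ => 1)
  simp only [integral_const, probReal_univ, smul_eq_mul, mul_one] at h1
  rw [Real.exp_neg, inv_mul_eq_div, eq_div_iff (Real.exp_pos _).ne', one_mul] at h1
  exact h1.symm

theorem integrable_inner_proxForward (hh : 0 < h) (x v : EuclideanSpace ℝ (Fin d)) :
    Integrable (fun y => ⟪v, y - x⟫ / h) (proxForward h x) := by
  refine ((integrable_exp_inner_proxForward hh x v).add
    (integrable_exp_inner_proxForward hh x (-v))).mono' (by fun_prop)
    (Filter.Eventually.of_forall fun y => ?_)
  simp only [inner_neg_left, Pi.add_apply, Real.norm_eq_abs, neg_div]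
  rw [abs_le]
  have h1 := Real.add_one_le_exp (⟪v, y - x⟫ / h)
  have h2 := Real.add_one_le_exp (-(⟪v, y - x⟫ / h))
  have h3 := Real.exp_pos (⟪v, y - x⟫ / h)
  have h4 := Real.exp_pos (-(⟪v, y - x⟫ / h))
  constructor <;> linarith

end GaussianKernel

/-! ### Gradients of Gaussian averages -/

section Gradient

theorem LocallyLipschitz.comp_contDiffAt {X E F : Type*} [PseudoEMetricSpace X]
    [NormedAddCommGroup E] [NormedSpace ℝ E] [NormedAddCommGroup F] [NormedSpace ℝ F]
    {φ : E → F} {f : X → E} (hf : LocallyLipschitz f)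
    (hφ : ∀ x, ContDiffAt ℝ 1 φ (f x)) : LocallyLipschitz (φ ∘ f) := by
  intro x
  obtain ⟨K, t, ht, hK⟩ := (hφ x).exists_lipschitzOnWith
  obtain ⟨K', s, hs, hK'⟩ := hf x
  refine ⟨K * K', s ∩ f ⁻¹' t, Filter.inter_mem hs (hf.continuous.continuousAt ht), ?_⟩
  exact hK.comp (hK'.mono Set.inter_subset_left) fun y hy => hy.2

variable {d : ℕ} {h m M : ℝ} {u : EuclideanSpace ℝ (Fin d) → ℝ}

theorem integrable_of_bounded_proxForward (hh : 0 < h) (hu : Measurable u)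
    (hM : ∀ y, |u y| ≤ M) (x : EuclideanSpace ℝ (Fin d)) :
    Integrable u (proxForward h x) := by
  have := isMarkovKernel_proxForward d hh
  exact Integrable.of_bound hu.aestronglyMeasurable M (Filter.Eventually.of_forall hM)

theorem le_integral_proxForward (hh : 0 < h) (hu : Measurable u) (hm : ∀ y, m ≤ u y)
    (hM : ∀ y, |u y| ≤ M) (x : EuclideanSpace ℝ (Fin d)) : m ≤ ∫ y, u y ∂proxForward h x := by
  have := isMarkovKernel_proxForward d hh
  calc m = ∫ _, m ∂proxForward h x := by simp
    _ ≤ _ := integral_mono (integrable_const _) (integrable_of_bounded_proxForward hh hu hM x) hm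

theorem integral_proxForward_le (hh : 0 < h) (hu : Measurable u) (hm : ∀ y, u y ≤ m)
    (hM : ∀ y, |u y| ≤ M) (x : EuclideanSpace ℝ (Fin d)) : ∫ y, u y ∂proxForward h x ≤ m := by
  have := isMarkovKernel_proxForward d hh
  calc _ ≤ ∫ _, m ∂proxForward h x :=
        integral_mono (integrable_of_bounded_proxForward hh hu hM x) (integrable_const _) hm
    _ = m := by simp

/-- A Gaussian average is `exp (-‖x‖² / (2h))` times a Laplace transform, which is convex in `x`;
this gives local Lipschitz continuity without differentiating under the integral sign. -/
theorem locallyLipschitz_rpow_integral_proxForward (hh : 0 < h) (hu : Measurable u) (hm0 : 0 < m)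
    (hm : ∀ y, m ≤ u y) (hM : ∀ y, |u y| ≤ M) (r : ℝ) :
    LocallyLipschitz (fun x => (∫ y, u y ∂proxForward h x) ^ r) := by
  set c : EuclideanSpace ℝ (Fin d) → ℝ :=
    fun v => ∫ y, Real.exp (⟪v, y⟫ / h) * u y ∂proxForward h 0 with hc
  have hA : ∀ x, ∫ y, u y ∂proxForward h x = Real.exp (-(‖x‖ ^ 2 / (2 * h))) * c x := by
    intro x
    have := integral_proxForward_add hh 0 x u
    simpa using this
  have hcpos : ∀ x, 0 < c x := by
    intro x
    have h1 := le_integral_proxForward hh hu hm hM x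
    rw [hA x] at h1
    exact (mul_pos_iff_of_pos_left (Real.exp_pos _)).1 (hm0.trans_le h1)
  have hint : ∀ x, Integrable (fun y => Real.exp (⟪x, y⟫ / h) * u y) (proxForward h 0) := by
    intro x
    have := (integrable_proxForward_add_iff hh 0 x u).1
      (integrable_of_bounded_proxForward hh hu hM _)
    simpa using this
  have hconv : ConvexOn ℝ Set.univ c := by
    refine ⟨convex_univ, fun x _ y _ a b ha hb hab => ?_⟩
    simp only [hc, smul_eq_mul]
    rw [← integral_const_mul, ← integral_const_mul,
      ← integral_add ((hint x).const_mul _) ((hint y).const_mul _)]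
    refine integral_mono (hint _) (((hint x).const_mul _).add ((hint y).const_mul _)) fun z => ?_
    have h1 := convexOn_exp.2 (Set.mem_univ (⟪x, z⟫ / h)) (Set.mem_univ (⟪y, z⟫ / h)) ha hb hab
    simp only [smul_eq_mul] at h1
    have h2 : ⟪a • x + b • y, z⟫ / h = a * (⟪x, z⟫ / h) + b * (⟪y, z⟫ / h) := by
      rw [inner_add_left, real_inner_smul_left, real_inner_smul_left]; ring
    have h3 : 0 ≤ u z := hm0.le.trans (hm z)
    simp only [h2]
    nlinarith [mul_le_mul_of_nonneg_right h1 h3]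
  have hpair : LocallyLipschitz (fun x => (x, c x)) :=
    LocallyLipschitz.id.prodMk hconv.locallyLipschitz
  have hfun : (fun x => (∫ y, u y ∂proxForward h x) ^ r)
      = (fun z : EuclideanSpace ℝ (Fin d) × ℝ =>
          (Real.exp (-(‖z.1‖ ^ 2 / (2 * h))) * z.2) ^ r) ∘ fun x => (x, c x) := by
    ext x
    simp [hA x]
  rw [hfun]
  refine hpair.comp_contDiffAt fun x => ContDiffAt.rpow_const_of_ne ?_ ?_
  · have : ContDiff ℝ 1 (fun z : EuclideanSpace ℝ (Fin d) × ℝ => ‖z.1‖ ^ 2) :=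
      contDiff_fst.norm_sq ℝ
    exact (((this.div_const _).neg.exp).mul contDiff_snd).contDiffAt
  · exact (mul_pos (Real.exp_pos _) (hcpos x)).ne'

/-- Tangent lower bound for a Gaussian average along a line, from `1 + s ≤ exp s`. It identifies
directional derivatives wherever they exist. -/
theorem le_integral_proxForward_add_smul (hh : 0 < h) (hu : Measurable u)
    (h0 : ∀ y, 0 ≤ u y) (hM : ∀ y, |u y| ≤ M) (x v : EuclideanSpace ℝ (Fin d)) (t : ℝ) :
    Real.exp (-(t ^ 2 * ‖v‖ ^ 2 / (2 * h))) *
      (∫ y, u y ∂proxForward h x + t * ∫ y, u y * (⟪v, y - x⟫ / h) ∂proxForward h x)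
      ≤ ∫ y, u y ∂proxForward h (x + t • v) := by
  have hiu := integrable_of_bounded_proxForward hh hu hM x
  have hiD : Integrable (fun y => u y * (⟪v, y - x⟫ / h)) (proxForward h x) :=
    (integrable_inner_proxForward hh x v).bdd_mul hu.aestronglyMeasurable
      (Filter.Eventually.of_forall hM)
  rw [integral_proxForward_add hh, norm_smul, mul_pow, Real.norm_eq_abs, sq_abs]
  refine mul_le_mul_of_nonneg_left ?_ (Real.exp_pos _).le
  rw [← integral_const_mul, ← integral_add hiu (hiD.const_mul _)]
  refine integral_mono (hiu.add (hiD.const_mul _))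
    ((integrable_proxForward_add_iff hh x _ u).1
      (integrable_of_bounded_proxForward hh hu hM _)) fun y => ?_
  have h1 := Real.add_one_le_exp (⟪t • v, y - x⟫ / h)
  have h2 : ⟪t • v, y - x⟫ / h = t * (⟪v, y - x⟫ / h) := by
    rw [real_inner_smul_left]; ring
  rw [h2] at h1
  simp only [h2]
  nlinarith [mul_le_mul_of_nonneg_right h1 (h0 y)]

/-- Reverse logarithmic Sobolev inequality for the Gaussian kernel: the first Hermite coefficient
in direction `v` is controlled by the entropy. This is the Gibbs variational principle applied to
linear functions, optimized over their slope. -/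
theorem sq_integral_mul_inner_le (hh : 0 < h) (hu : Measurable u) (hm0 : 0 < m)
    (hm : ∀ y, m ≤ u y) (hM : ∀ y, |u y| ≤ M) {x : EuclideanSpace ℝ (Fin d)}
    (hlog : Integrable (fun y => u y * Real.log (u y)) (proxForward h x))
    (v : EuclideanSpace ℝ (Fin d)) :
    (∫ y, u y * (⟪v, y - x⟫ / h) ∂proxForward h x) ^ 2 ≤
      2 / h * ‖v‖ ^ 2 * (∫ y, u y ∂proxForward h x) *
        (∫ y, u y * Real.log (u y) ∂proxForward h x
          - (∫ y, u y ∂proxForward h x) * Real.log (∫ y, u y ∂proxForward h x)) := by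
  have hiu := integrable_of_bounded_proxForward hh hu hM x
  have hiD : Integrable (fun y => u y * (⟪v, y - x⟫ / h)) (proxForward h x) :=
    (integrable_inner_proxForward hh x v).bdd_mul hu.aestronglyMeasurable
      (Filter.Eventually.of_forall hM)
  have hApos : 0 < ∫ y, u y ∂proxForward h x :=
    hm0.trans_le (le_integral_proxForward hh hu hm hM x)
  set A := ∫ y, u y ∂proxForward h x with hA
  set D := ∫ y, u y * (⟪v, y - x⟫ / h) ∂proxForward h x with hD
  set S := ∫ y, u y * Real.log (u y) ∂proxForward h x with hS
  have key : ∀ l : ℝ,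
      0 ≤ A * (‖v‖ ^ 2 / (2 * h)) * (l * l) + (-D) * l + (S - A * Real.log A) := by
    intro l
    set c := l ^ 2 * ‖v‖ ^ 2 / (2 * h) with hc
    have hexp : Integrable (fun y => A * Real.exp (-c) * Real.exp (⟪l • v, y - x⟫ / h))
        (proxForward h x) := (integrable_exp_inner_proxForward hh x (l • v)).const_mul _
    have hpt : ∀ y, l * (u y * (⟪v, y - x⟫ / h)) ≤
        (u y * Real.log (u y) + (c - Real.log A - 1) * u y) +
          A * Real.exp (-c) * Real.exp (⟪l • v, y - x⟫ / h) := by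
      intro y
      have hpos : 0 < u y := hm0.trans_le (hm y)
      have h2 : ⟪l • v, y - x⟫ / h = l * (⟪v, y - x⟫ / h) := by
        rw [real_inner_smul_left]; ring
      rw [h2, mul_assoc, ← Real.exp_add]
      have h3 := Real.add_one_le_exp
        (Real.log A + (-c + l * (⟪v, y - x⟫ / h)) - Real.log (u y))
      rw [Real.exp_sub, Real.exp_add, Real.exp_log hApos, Real.exp_log hpos,
        le_div_iff₀ hpos] at h3
      linarith
    have hsum : Integrable (fun y => u y * Real.log (u y) + (c - Real.log A - 1) * u y)
        (proxForward h x) := hlog.add (hiu.const_mul _)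
    have h4 := integral_mono (hiD.const_mul l) (hsum.add hexp) hpt
    simp only [Pi.add_apply] at h4
    rw [integral_add hsum hexp, integral_add hlog (hiu.const_mul _),
      integral_const_mul, integral_const_mul, integral_const_mul,
      integral_exp_inner_proxForward hh, norm_smul, mul_pow, Real.norm_eq_abs, sq_abs,
      ← hA, ← hD, ← hS, ← hc, mul_assoc A, ← Real.exp_add, neg_add_cancel, Real.exp_zero] at h4
    have h5 : c = ‖v‖ ^ 2 / (2 * h) * (l * l) := by rw [hc]; ring
    rw [mul_assoc A, ← h5]
    linarith
  have h6 := discrim_le_zero key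
  have h7 : 2 / h * ‖v‖ ^ 2 * A * (S - A * Real.log A)
      = 4 * (A * (‖v‖ ^ 2 / (2 * h))) * (S - A * Real.log A) := by
    field_simp; ring
  rw [h7]
  unfold discrim at h6
  linarith

theorem mul_log_integral_le (hh : 0 < h) (hu : Measurable u) (h0 : ∀ y, 0 ≤ u y)
    (hM : ∀ y, |u y| ≤ M) {x : EuclideanSpace ℝ (Fin d)}
    (hlog : Integrable (fun y => u y * Real.log (u y)) (proxForward h x)) :
    (∫ y, u y ∂proxForward h x) * Real.log (∫ y, u y ∂proxForward h x)
      ≤ ∫ y, u y * Real.log (u y) ∂proxForward h x := by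
  have := isMarkovKernel_proxForward d hh
  exact Real.convexOn_mul_log.map_integral_le Real.continuous_mul_log.continuousOn isClosed_Ici
    (Filter.Eventually.of_forall h0) (integrable_of_bounded_proxForward hh hu hM x) hlog

/-- Pointwise gradient bound for a power of a Gaussian average by its entropy. -/
theorem norm_fderiv_rpow_integral_proxForward_sq_le (hh : 0 < h) (hu : Measurable u)
    (hm0 : 0 < m) (hm : ∀ y, m ≤ u y) (hM : ∀ y, |u y| ≤ M) {x : EuclideanSpace ℝ (Fin d)}
    (hlog : Integrable (fun y => u y * Real.log (u y)) (proxForward h x)) {r : ℝ} (hr : 0 ≤ r) :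
    ‖fderiv ℝ (fun x => (∫ y, u y ∂proxForward h x) ^ r) x‖ ^ 2 ≤
      2 / h * r ^ 2 * ((∫ y, u y ∂proxForward h x) ^ r) ^ 2 *
        ((∫ y, u y * Real.log (u y) ∂proxForward h x) / (∫ y, u y ∂proxForward h x)
          - Real.log (∫ y, u y ∂proxForward h x)) := by
  have h0 : ∀ y, 0 ≤ u y := fun y => hm0.le.trans (hm y)
  have hrl := sq_integral_mul_inner_le hh hu hm0 hm hM hlog
  have hjen := mul_log_integral_le hh hu h0 hM hlog
  have htouch := le_integral_proxForward_add_smul hh hu h0 hM x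
  have hApos : 0 < ∫ y, u y ∂proxForward h x :=
    hm0.trans_le (le_integral_proxForward hh hu hm hM x)
  set F := fun x => (∫ y, u y ∂proxForward h x) ^ r with hF
  have hFx : F x = (∫ y, u y ∂proxForward h x) ^ r := rfl
  set A := ∫ y, u y ∂proxForward h x with hA
  set S := ∫ y, u y * Real.log (u y) ∂proxForward h x with hS
  have hent : 0 ≤ S / A - Real.log A := by
    rw [sub_nonneg, le_div_iff₀ hApos]
    linarith
  -- At a point of non-differentiability `fderiv` is `0`, and the bound only says that the entropy
  -- is nonnegative.
  by_cases hdiff : DifferentiableAt ℝ F x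
  swap
  · rw [fderiv_zero_of_not_differentiableAt hdiff, norm_zero, zero_pow two_ne_zero]
    positivity
  have hdir : ∀ v, fderiv ℝ F x v
      = r * A ^ (r - 1) * ∫ y, u y * (⟪v, y - x⟫ / h) ∂proxForward h x := by
    intro v
    have htv := htouch v
    set D := ∫ y, u y * (⟪v, y - x⟫ / h) ∂proxForward h x with hD
    have hline : HasDerivAt (fun t : ℝ => F (x + t • v)) (fderiv ℝ F x v) 0 :=
      hdiff.hasFDerivAt.hasLineDerivAt v
    have hbase : HasDerivAt (fun t : ℝ => Real.exp (-(t ^ 2 * ‖v‖ ^ 2 / (2 * h))) * (A + t * D))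
        D 0 := by
      have e1 : HasDerivAt (fun t : ℝ => -(t ^ 2 * ‖v‖ ^ 2 / (2 * h))) 0 0 := by
        exact (((hasDerivAt_pow 2 (0 : ℝ)).mul_const (‖v‖ ^ 2)).div_const (2 * h)).neg.congr_deriv
          (by simp)
      have e2 : HasDerivAt (fun t : ℝ => A + t * D) D 0 := by
        simpa using ((hasDerivAt_id (0 : ℝ)).mul_const D).const_add A
      exact (e1.exp.mul e2).congr_deriv (by simp)
    have hlow := hbase.rpow_const (p := r) (Or.inl (by simpa using hApos.ne'))
    have hmin : IsLocalMin (fun t : ℝ => F (x + t • v) -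
        (Real.exp (-(t ^ 2 * ‖v‖ ^ 2 / (2 * h))) * (A + t * D)) ^ r) 0 := by
      have hev : ∀ᶠ t : ℝ in nhds 0, 0 < A + t * D := by
        have : ContinuousAt (fun t : ℝ => A + t * D) 0 := by fun_prop
        exact this.eventually (lt_mem_nhds (by simpa using hApos))
      filter_upwards [hev] with t ht
      have e1 : (Real.exp (-(t ^ 2 * ‖v‖ ^ 2 / (2 * h))) * (A + t * D)) ^ r ≤ F (x + t • v) :=
        Real.rpow_le_rpow (by positivity) (htv t) hr
      simpa [hFx] using e1
    have hz := hmin.hasDerivAt_eq_zero (hline.sub hlow)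
    simp only [ne_eq, OfNat.ofNat_ne_zero, not_false_eq_true, zero_pow, zero_mul, zero_div,
      neg_zero, Real.exp_zero, add_zero, one_mul] at hz
    linarith
  set B := 2 / h * r ^ 2 * (A ^ r) ^ 2 * (S / A - Real.log A) with hB
  have hB0 : 0 ≤ B := by positivity
  have hnorm : ‖fderiv ℝ F x‖ ≤ √B := by
    refine ContinuousLinearMap.opNorm_le_bound _ (Real.sqrt_nonneg _) fun v => ?_
    rw [Real.norm_eq_abs]
    refine abs_le_of_sq_le_sq ?_ (by positivity)
    rw [hdir, mul_pow, mul_pow √B, Real.sq_sqrt hB0, mul_pow, Real.rpow_sub_one hApos.ne']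
    calc _ ≤ r ^ 2 * (A ^ r / A) ^ 2 * (2 / h * ‖v‖ ^ 2 * A * (S - A * Real.log A)) :=
          mul_le_mul_of_nonneg_left (hrl v) (by positivity)
      _ = B * ‖v‖ ^ 2 := by
          rw [hB]; field_simp
  calc ‖fderiv ℝ F x‖ ^ 2 ≤ √B ^ 2 := by gcongr
    _ = B := Real.sq_sqrt hB0

end Gradient

/-! ### Power means of Gaussian averages -/

noncomputable section PowerMeans

variable {d : ℕ} {h K : ℝ} {X : EuclideanSpace ℝ (Fin d) → ℝ}

/-- Logarithm of the power mean `(∫ exp (θ X) dN(x, h I))^{1/θ}` of `exp X` under the Gaussian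
centered at `x`. -/
def logPowerMean (h : ℝ) (X : EuclideanSpace ℝ (Fin d) → ℝ) (θ : ℝ)
    (x : EuclideanSpace ℝ (Fin d)) : ℝ :=
  Real.log (∫ y, Real.exp (θ * X y) ∂proxForward h x) / θ

/-- The derivative of `logPowerMean` in the exponent `θ`, for bounded `X`. -/
def logPowerMeanDeriv (h : ℝ) (X : EuclideanSpace ℝ (Fin d) → ℝ) (θ : ℝ)
    (x : EuclideanSpace ℝ (Fin d)) : ℝ :=
  (θ * ((∫ y, X y * Real.exp (θ * X y) ∂proxForward h x)
      / ∫ y, Real.exp (θ * X y) ∂proxForward h x)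
    - Real.log (∫ y, Real.exp (θ * X y) ∂proxForward h x)) / θ ^ 2

theorem exp_mul_mem_bounds {θ K t : ℝ} (hθ : 0 ≤ θ) (ht : |t| ≤ K) :
    Real.exp (-(θ * K)) ≤ Real.exp (θ * t) ∧ |Real.exp (θ * t)| ≤ Real.exp (θ * K) := by
  obtain ⟨h1, h2⟩ := abs_le.1 ht
  rw [abs_of_pos (Real.exp_pos _)]
  constructor <;> apply Real.exp_le_exp.2 <;> nlinarith

theorem integrable_exp_mul_of_bounded (hh : 0 < h) (hX : Measurable X) (hK : ∀ y, |X y| ≤ K)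
    (θ : ℝ) (x : EuclideanSpace ℝ (Fin d)) :
    Integrable (fun y => Real.exp (θ * X y)) (proxForward h x) := by
  refine integrable_of_bounded_proxForward (M := Real.exp (|θ| * K)) hh (by fun_prop)
    (fun y => ?_) x
  rw [abs_of_pos (Real.exp_pos _)]
  refine Real.exp_le_exp.2 ((le_abs_self _).trans ?_)
  rw [abs_mul]
  exact mul_le_mul_of_nonneg_left (hK y) (abs_nonneg _)

theorem integrable_mul_exp_mul_of_bounded (hh : 0 < h) (hX : Measurable X)
    (hK : ∀ y, |X y| ≤ K) (θ : ℝ) (x : EuclideanSpace ℝ (Fin d)) :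
    Integrable (fun y => X y * Real.exp (θ * X y)) (proxForward h x) :=
  (integrable_exp_mul_of_bounded hh hX hK θ x).bdd_mul hX.aestronglyMeasurable
    (Filter.Eventually.of_forall hK)

theorem integral_exp_mul_pos (hh : 0 < h) (hX : Measurable X) (hK : ∀ y, |X y| ≤ K) (θ : ℝ)
    (x : EuclideanSpace ℝ (Fin d)) : 0 < ∫ y, Real.exp (θ * X y) ∂proxForward h x := by
  have := isMarkovKernel_proxForward d hh
  exact mgf_pos (X := X) (integrable_exp_mul_of_bounded hh hX hK θ x)

theorem abs_log_integral_exp_mul_le (hh : 0 < h) (hX : Measurable X) (hK : ∀ y, |X y| ≤ K)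
    {θ : ℝ} (hθ : 0 ≤ θ) (x : EuclideanSpace ℝ (Fin d)) :
    |Real.log (∫ y, Real.exp (θ * X y) ∂proxForward h x)| ≤ θ * K := by
  have hu : Measurable fun y => Real.exp (θ * X y) := by fun_prop
  have h1 := le_integral_proxForward hh hu (fun y => (exp_mul_mem_bounds hθ (hK y)).1)
    (fun y => (exp_mul_mem_bounds hθ (hK y)).2) x
  have h2 := integral_proxForward_le hh hu
    (fun y => (le_abs_self _).trans (exp_mul_mem_bounds hθ (hK y)).2)
    (fun y => (exp_mul_mem_bounds hθ (hK y)).2) x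
  have hpos := integral_exp_mul_pos hh hX hK θ x
  rw [abs_le]
  exact ⟨(Real.le_log_iff_exp_le hpos).2 h1, (Real.log_le_iff_le_exp hpos).2 h2⟩

theorem abs_logPowerMean_le (hh : 0 < h) (hX : Measurable X) (hK : ∀ y, |X y| ≤ K)
    {θ : ℝ} (hθ : 0 < θ) (x : EuclideanSpace ℝ (Fin d)) : |logPowerMean h X θ x| ≤ K := by
  rw [logPowerMean, abs_div, abs_of_pos hθ, div_le_iff₀ hθ, mul_comm]
  exact abs_log_integral_exp_mul_le hh hX hK hθ.le x

theorem abs_logPowerMeanDeriv_le (hh : 0 < h) (hX : Measurable X) (hK : ∀ y, |X y| ≤ K)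
    {θ : ℝ} (hθ : 0 < θ) (x : EuclideanSpace ℝ (Fin d)) :
    |logPowerMeanDeriv h X θ x| ≤ 2 * K / θ := by
  have hpos := integral_exp_mul_pos hh hX hK θ x
  have h1 : |(∫ y, X y * Real.exp (θ * X y) ∂proxForward h x)
      / ∫ y, Real.exp (θ * X y) ∂proxForward h x| ≤ K := by
    rw [abs_div, abs_of_pos hpos, div_le_iff₀ hpos, ← integral_const_mul]
    refine abs_integral_le_integral_abs.trans (integral_mono
      (integrable_mul_exp_mul_of_bounded hh hX hK θ x).abs
      ((integrable_exp_mul_of_bounded hh hX hK θ x).const_mul _) fun y => ?_)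
    simp only [abs_mul, Real.abs_exp]
    exact mul_le_mul_of_nonneg_right (hK y) (Real.exp_pos _).le
  have h2 := abs_log_integral_exp_mul_le hh hX hK hθ.le x
  rw [logPowerMeanDeriv, abs_div, abs_of_pos (pow_pos hθ 2), div_le_div_iff₀ (by positivity) hθ]
  have h3 := abs_sub (θ * ((∫ y, X y * Real.exp (θ * X y) ∂proxForward h x)
      / ∫ y, Real.exp (θ * X y) ∂proxForward h x))
      (Real.log (∫ y, Real.exp (θ * X y) ∂proxForward h x))
  rw [abs_mul, abs_of_pos hθ] at h3
  have h4 := mul_le_mul_of_nonneg_left h1 hθ.le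
  nlinarith

theorem hasDerivAt_logPowerMean (hh : 0 < h) (hX : Measurable X) (hK : ∀ y, |X y| ≤ K)
    {θ : ℝ} (hθ : 0 < θ) (x : EuclideanSpace ℝ (Fin d)) :
    HasDerivAt (fun θ => logPowerMean h X θ x) (logPowerMeanDeriv h X θ x) θ := by
  have hset : integrableExpSet X (proxForward h x) = Set.univ :=
    Set.eq_univ_of_forall fun t => integrable_exp_mul_of_bounded hh hX hK t x
  have h1 : HasDerivAt (fun θ => ∫ y, Real.exp (θ * X y) ∂proxForward h x)
      (∫ y, X y * Real.exp (θ * X y) ∂proxForward h x) θ :=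
    hasDerivAt_mgf (X := X) (by rw [hset, interior_univ]; trivial)
  have hpos := integral_exp_mul_pos hh hX hK θ x
  refine ((h1.log hpos.ne').div (hasDerivAt_id θ) hθ.ne').congr_deriv ?_
  simp only [logPowerMeanDeriv, id]
  ring

theorem measurable_integral_proxForward (hh : 0 < h) {u : EuclideanSpace ℝ (Fin d) → ℝ}
    (hu : Measurable u) : Measurable fun x => ∫ y, u y ∂proxForward h x :=
  have := isMarkovKernel_proxForward d hh
  (StronglyMeasurable.integral_kernel_prod_right (κ := proxForward h) (f := fun _ y => u y)
    (hu.comp measurable_snd).stronglyMeasurable).measurable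

theorem measurable_logPowerMean (hh : 0 < h) (hX : Measurable X) (θ : ℝ) :
    Measurable (logPowerMean h X θ) := by
  have := measurable_integral_proxForward hh (u := fun y => Real.exp (θ * X y))
    (by fun_prop)
  unfold logPowerMean
  fun_prop

theorem measurable_logPowerMeanDeriv (hh : 0 < h) (hX : Measurable X) (θ : ℝ) :
    Measurable (logPowerMeanDeriv h X θ) := by
  have h1 := measurable_integral_proxForward hh (u := fun y => Real.exp (θ * X y))
    (by fun_prop)
  have h2 := measurable_integral_proxForward hh (u := fun y => X y * Real.exp (θ * X y))
    (by fun_prop)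
  unfold logPowerMeanDeriv
  fun_prop

/-- A logarithmic Sobolev inequality with constant `h / κ`, applied to the power
`exp (b v / 2)`, `v = logPowerMean h X θ`, of a Gaussian average. Because of the pointwise bound
`(h / 2) |∇v|² ≤ ∂v/∂θ`, the Dirichlet energy is traded for the growth of `v` in `θ`. -/
theorem entropy_exp_logPowerMean_le {π : Measure (EuclideanSpace ℝ (Fin d))}
    [IsProbabilityMeasure π] (hh : 0 < h) {κ : ℝ} (hκ : 0 < κ) (hlsi : SatisfiesLSI π (h / κ))
    (hX : Measurable X) (hK : ∀ y, |X y| ≤ K) {θ b : ℝ} (hθ : 0 < θ) (hb : 0 ≤ b) :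
    κ * ((∫ x, Real.exp (b * logPowerMean h X θ x) * (b * logPowerMean h X θ x) ∂π)
        - (∫ x, Real.exp (b * logPowerMean h X θ x) ∂π)
          * Real.log (∫ x, Real.exp (b * logPowerMean h X θ x) ∂π))
      ≤ b ^ 2 * ∫ x, Real.exp (b * logPowerMean h X θ x) * logPowerMeanDeriv h X θ x ∂π := by
  set f : EuclideanSpace ℝ (Fin d) → ℝ :=
    fun x => (∫ y, Real.exp (θ * X y) ∂proxForward h x) ^ (b / (2 * θ)) with hf
  have hu : Measurable fun y => Real.exp (θ * X y) := by fun_prop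
  have hfsq : ∀ x, f x ^ 2 = Real.exp (b * logPowerMean h X θ x) := by
    intro x
    have hpos := integral_exp_mul_pos hh hX hK θ x
    simp only [hf, logPowerMean]
    rw [Real.rpow_def_of_pos hpos, ← Real.exp_nat_mul]
    congr 1
    push_cast
    field_simp
  have hloc : LocallyLipschitz f :=
    locallyLipschitz_rpow_integral_proxForward hh hu (Real.exp_pos (-(θ * K)))
      (fun y => (exp_mul_mem_bounds hθ.le (hK y)).1)
      (fun y => (exp_mul_mem_bounds hθ.le (hK y)).2) _
  have hexpb : ∀ x, Real.exp (b * logPowerMean h X θ x) ≤ Real.exp (b * K) := fun x =>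
    Real.exp_le_exp.2 (mul_le_mul_of_nonneg_left
      ((le_abs_self _).trans (abs_logPowerMean_le hh hX hK hθ x)) hb)
  have hgrad : ∀ x, ‖fderiv ℝ f x‖ ^ 2 ≤
      b ^ 2 / (2 * h) * (Real.exp (b * logPowerMean h X θ x) * logPowerMeanDeriv h X θ x) := by
    intro x
    have hpos := integral_exp_mul_pos hh hX hK θ x
    have hmul : (fun y => Real.exp (θ * X y) * Real.log (Real.exp (θ * X y)))
        = fun y => θ * (X y * Real.exp (θ * X y)) := by
      ext y; rw [Real.log_exp]; ring
    have hint : Integrable (fun y => Real.exp (θ * X y) * Real.log (Real.exp (θ * X y)))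
        (proxForward h x) := by
      rw [hmul]
      exact (integrable_mul_exp_mul_of_bounded hh hX hK θ x).const_mul θ
    have h1 := norm_fderiv_rpow_integral_proxForward_sq_le hh hu (Real.exp_pos (-(θ * K)))
      (fun y => (exp_mul_mem_bounds hθ.le (hK y)).1)
      (fun y => (exp_mul_mem_bounds hθ.le (hK y)).2) hint
      (show 0 ≤ b / (2 * θ) by positivity)
    rw [hmul, integral_const_mul] at h1
    refine h1.trans (le_of_eq ?_)
    have h2 := hfsq x
    simp only [hf] at h2
    rw [h2, logPowerMeanDeriv]
    field_simp
  have hmV := measurable_logPowerMean hh hX θ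
  have hmD := measurable_logPowerMeanDeriv hh hX θ
  have hbd : ∀ x, |Real.exp (b * logPowerMean h X θ x) * logPowerMeanDeriv h X θ x|
      ≤ Real.exp (b * K) * (2 * K / θ) := by
    intro x
    rw [abs_mul, Real.abs_exp]
    exact mul_le_mul (hexpb x) (abs_logPowerMeanDeriv_le hh hX hK hθ x) (abs_nonneg _)
      (Real.exp_pos _).le
  have hintD : Integrable
      (fun x => Real.exp (b * logPowerMean h X θ x) * logPowerMeanDeriv h X θ x) π :=
    Integrable.of_bound (by fun_prop) _ (Filter.Eventually.of_forall hbd)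
  have hmf : Measurable f := hloc.continuous.measurable
  have hf2 : MemLp f 2 π := by
    refine (memLp_two_iff_integrable_sq hmf.aestronglyMeasurable).2 ?_
    simp_rw [hfsq]
    refine Integrable.of_bound (by fun_prop) (Real.exp (b * K))
      (Filter.Eventually.of_forall fun x => ?_)
    rw [Real.norm_eq_abs, Real.abs_exp]
    exact hexpb x
  have hmfd : Measurable fun x => fderiv ℝ f x := measurable_fderiv ℝ f
  have hintg : Integrable (fun x => ‖fderiv ℝ f x‖ ^ 2) π := by
    refine (hintD.const_mul (b ^ 2 / (2 * h))).mono' (by fun_prop)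
      (Filter.Eventually.of_forall fun x => ?_)
    rw [Real.norm_eq_abs, abs_of_nonneg (sq_nonneg _)]
    exact hgrad x
  have hfd2 : MemLp (fun x => fderiv ℝ f x) 2 π :=
    (memLp_two_iff_integrable_sq_norm hmfd.aestronglyMeasurable).2 hintg
  have hL := (hlsi f hloc hf2 hfd2).2
  simp_rw [hfsq, Real.log_exp] at hL
  have h3 := integral_mono hintg (hintD.const_mul (b ^ 2 / (2 * h))) hgrad
  rw [integral_const_mul] at h3
  calc _ ≤ κ * (2 * (h / κ) * ∫ x, ‖fderiv ℝ f x‖ ^ 2 ∂π) :=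
        mul_le_mul_of_nonneg_left hL hκ.le
    _ ≤ κ * (2 * (h / κ) * (b ^ 2 / (2 * h) *
          ∫ x, Real.exp (b * logPowerMean h X θ x) * logPowerMeanDeriv h X θ x ∂π)) := by
        gcongr
    _ = _ := by field_simp

theorem hasDerivAt_integral_exp_logPowerMean {π : Measure (EuclideanSpace ℝ (Fin d))}
    [IsProbabilityMeasure π] (hh : 0 < h) (hX : Measurable X) (hK : ∀ y, |X y| ≤ K)
    (α κ : ℝ) {θ : ℝ} (hθ : 0 < θ) :
    HasDerivAt (fun θ => ∫ x, Real.exp ((α - κ * θ) * logPowerMean h X θ x) ∂π)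
      (∫ x, Real.exp ((α - κ * θ) * logPowerMean h X θ x) *
        (-κ * logPowerMean h X θ x + (α - κ * θ) * logPowerMeanDeriv h X θ x) ∂π) θ := by
  have hK0 : 0 ≤ K := (abs_nonneg _).trans (hK 0)
  set B := |α| + |κ| * (2 * θ) with hB
  have hB0 : 0 ≤ B := by positivity
  have hs : Set.Ioo (θ / 2) (2 * θ) ∈ nhds θ := Ioo_mem_nhds (by linarith) (by linarith)
  have hcoef : ∀ t ∈ Set.Ioo (θ / 2) (2 * θ), |α - κ * t| ≤ B := by
    intro t ht
    have ht0 : 0 < t := by linarith [ht.1]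
    refine (abs_sub _ _).trans ?_
    rw [abs_mul, abs_of_pos ht0]
    have := mul_le_mul_of_nonneg_left ht.2.le (abs_nonneg κ)
    linarith
  have hmV := fun t => measurable_logPowerMean hh hX t
  have hmD := fun t => measurable_logPowerMeanDeriv hh hX t
  have hexp : ∀ t ∈ Set.Ioo (θ / 2) (2 * θ), ∀ x,
      Real.exp ((α - κ * t) * logPowerMean h X t x) ≤ Real.exp (B * K) := by
    intro t ht x
    have ht0 : 0 < t := by linarith [ht.1]
    refine Real.exp_le_exp.2 ((le_abs_self _).trans ?_)
    rw [abs_mul]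
    exact mul_le_mul (hcoef t ht) (abs_logPowerMean_le hh hX hK ht0 x) (abs_nonneg _) hB0
  have hθs : θ ∈ Set.Ioo (θ / 2) (2 * θ) := mem_of_mem_nhds hs
  refine (hasDerivAt_integral_of_dominated_loc_of_deriv_le
    (F := fun t x => Real.exp ((α - κ * t) * logPowerMean h X t x))
    (F' := fun t x => Real.exp ((α - κ * t) * logPowerMean h X t x) *
        (-κ * logPowerMean h X t x + (α - κ * t) * logPowerMeanDeriv h X t x))
    (bound := fun _ => Real.exp (B * K) * (|κ| * K + B * (4 * K / θ))) hs
    (Filter.Eventually.of_forall fun t => ?_) ?_ ?_ ?_ (integrable_const _) ?_).2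
  · have := hmV t
    fun_prop
  · have := hmV θ
    refine Integrable.of_bound (by fun_prop) (Real.exp (B * K))
      (Filter.Eventually.of_forall fun x => ?_)
    rw [Real.norm_eq_abs, Real.abs_exp]
    exact hexp θ hθs x
  · have := hmV θ
    have := hmD θ
    fun_prop
  · refine Filter.Eventually.of_forall fun x t ht => ?_
    have ht0 : 0 < t := by linarith [ht.1]
    rw [Real.norm_eq_abs, abs_mul, Real.abs_exp]
    refine mul_le_mul (hexp t ht x) ?_ (abs_nonneg _) (Real.exp_pos _).le
    refine (abs_add_le _ _).trans (add_le_add ?_ ?_)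
    · rw [abs_mul, abs_neg]
      exact mul_le_mul_of_nonneg_left (abs_logPowerMean_le hh hX hK ht0 x) (abs_nonneg _)
    · rw [abs_mul]
      refine mul_le_mul (hcoef t ht) ((abs_logPowerMeanDeriv_le hh hX hK ht0 x).trans ?_)
        (abs_nonneg _) hB0
      rw [div_le_div_iff₀ ht0 hθ]
      nlinarith [ht.1]
  · refine Filter.Eventually.of_forall fun x t ht => ?_
    have ht0 : 0 < t := by linarith [ht.1]
    have h1 : HasDerivAt (fun t => α - κ * t) (-κ) t := by
      simpa using ((hasDerivAt_id t).const_mul κ).const_sub α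
    exact (h1.mul (hasDerivAt_logPowerMean hh hX hK ht0 x)).exp

/-- Hypercontractivity of the Gaussian kernel from `L^a(π * γ_h)` to `L^b(π)`,
`b - 1 = (1 + κ) (a - 1)`, for `exp X` with `X` bounded. The `L^{a + κ (a - θ)}(π)` norm of the
power mean of order `θ` increases from `θ = 1` to `θ = a`. -/
theorem log_integral_exp_logPowerMean_le {π : Measure (EuclideanSpace ℝ (Fin d))}
    [IsProbabilityMeasure π] (hh : 0 < h) {κ : ℝ} (hκ : 0 < κ) (hlsi : SatisfiesLSI π (h / κ))
    (hX : Measurable X) (hK : ∀ y, |X y| ≤ K) {a : ℝ} (ha : 1 < a) :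
    Real.log (∫ x, Real.exp ((a + κ * (a - 1)) * logPowerMean h X 1 x) ∂π) / (a + κ * (a - 1))
      ≤ Real.log (∫ x, Real.exp (a * logPowerMean h X a x) ∂π) / a := by
  -- The order `a + κ (a - θ)` is written as an affine function `(a + κ a) - κ θ` of `θ`.
  set I : ℝ → ℝ := fun θ => ∫ x, Real.exp ((a + κ * a - κ * θ) * logPowerMean h X θ x) ∂π with hI
  have hb : ∀ θ ≤ a, 0 < a + κ * a - κ * θ := by
    intro θ hθ
    nlinarith
  have hintexp : ∀ θ, 0 < θ → ∀ b, Integrable (fun x => Real.exp (b * logPowerMean h X θ x)) π := by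
    intro θ hθ b
    have := measurable_logPowerMean hh hX θ
    refine Integrable.of_bound (by fun_prop) (Real.exp (|b| * K))
      (Filter.Eventually.of_forall fun x => ?_)
    rw [Real.norm_eq_abs, Real.abs_exp]
    refine Real.exp_le_exp.2 ((le_abs_self _).trans ?_)
    rw [abs_mul]
    exact mul_le_mul_of_nonneg_left (abs_logPowerMean_le hh hX hK hθ x) (abs_nonneg _)
  have hIpos : ∀ θ, 0 < θ → 0 < I θ := fun θ hθ =>
    integral_exp_pos (hintexp θ hθ _)
  have hder : ∀ θ, 0 < θ → θ ≤ a → HasDerivAt (fun θ => Real.log (I θ) / (a + κ * a - κ * θ))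
      ((((∫ x, Real.exp ((a + κ * a - κ * θ) * logPowerMean h X θ x) *
        (-κ * logPowerMean h X θ x + (a + κ * a - κ * θ) * logPowerMeanDeriv h X θ x) ∂π) / I θ) *
          (a + κ * a - κ * θ) - Real.log (I θ) * (-κ)) / (a + κ * a - κ * θ) ^ 2) θ := by
    intro θ hθ hθa
    have h1 : HasDerivAt (fun t => a + κ * a - κ * t) (-κ) θ := by
      simpa using ((hasDerivAt_id θ).const_mul κ).const_sub (a + κ * a)
    exact ((hasDerivAt_integral_exp_logPowerMean hh hX hK (a + κ * a) κ hθ).log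
      (hIpos θ hθ).ne').div h1 (hb θ hθa).ne'
  have hmono : MonotoneOn (fun θ => Real.log (I θ) / (a + κ * a - κ * θ)) (Set.Icc 1 a) := by
    refine monotoneOn_of_deriv_nonneg (convex_Icc _ _) ?_ ?_ ?_
    · exact fun θ hθ => (hder θ (by linarith [hθ.1]) hθ.2).continuousAt.continuousWithinAt
    · rw [interior_Icc]
      exact fun θ hθ =>
        (hder θ (by linarith [hθ.1]) hθ.2.le).differentiableAt.differentiableWithinAt
    · rw [interior_Icc]
      intro θ hθ
      have hθ0 : 0 < θ := by linarith [hθ.1]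
      rw [(hder θ hθ0 hθ.2.le).deriv]
      have hbθ := hb θ hθ.2.le
      have hent := entropy_exp_logPowerMean_le (π := π) hh hκ hlsi hX hK hθ0 hbθ.le
      have hIθ := hIpos θ hθ0
      have hIdef : I θ = ∫ x, Real.exp ((a + κ * a - κ * θ) * logPowerMean h X θ x) ∂π := rfl
      rw [← hIdef] at hent
      refine div_nonneg ?_ (sq_nonneg _)
      have hmV := measurable_logPowerMean hh hX θ
      have hmD := measurable_logPowerMeanDeriv hh hX θ
      set b := a + κ * a - κ * θ with hbdef
      have i1 : Integrable (fun x => Real.exp (b * logPowerMean h X θ x) *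
          (b * logPowerMean h X θ x)) π := by
        refine (hintexp θ hθ0 b).mul_bdd (c := b * K) (by fun_prop)
          (Filter.Eventually.of_forall fun x => ?_)
        rw [Real.norm_eq_abs, abs_mul, abs_of_pos hbθ]
        exact mul_le_mul_of_nonneg_left (abs_logPowerMean_le hh hX hK hθ0 x) hbθ.le
      have i2 : Integrable (fun x => Real.exp (b * logPowerMean h X θ x) *
          logPowerMeanDeriv h X θ x) π :=
        (hintexp θ hθ0 b).mul_bdd (by fun_prop) (Filter.Eventually.of_forall
          (abs_logPowerMeanDeriv_le hh hX hK hθ0))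
      have hsplit : b * (∫ x, Real.exp (b * logPowerMean h X θ x) *
          (-κ * logPowerMean h X θ x + b * logPowerMeanDeriv h X θ x) ∂π)
          = -κ * (∫ x, Real.exp (b * logPowerMean h X θ x) * (b * logPowerMean h X θ x) ∂π)
            + b ^ 2 * ∫ x, Real.exp (b * logPowerMean h X θ x) * logPowerMeanDeriv h X θ x ∂π := by
        rw [← integral_const_mul, ← integral_const_mul, ← integral_const_mul,
          ← integral_add (i1.const_mul _) (i2.const_mul _)]
        congr 1
        ext x
        ring
      have hfac : ((∫ x, Real.exp (b * logPowerMean h X θ x) *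
          (-κ * logPowerMean h X θ x + b * logPowerMeanDeriv h X θ x) ∂π) / I θ) * b
            - Real.log (I θ) * (-κ)
          = (b * (∫ x, Real.exp (b * logPowerMean h X θ x) *
          (-κ * logPowerMean h X θ x + b * logPowerMeanDeriv h X θ x) ∂π)
            + κ * (I θ * Real.log (I θ))) / I θ := by
        generalize (∫ x, Real.exp (b * logPowerMean h X θ x) *
          (-κ * logPowerMean h X θ x + b * logPowerMeanDeriv h X θ x) ∂π) = J
        field_simp
        ring
      rw [hfac, hsplit]
      refine div_nonneg ?_ hIθ.le
      linarith
  have hfin := hmono (Set.left_mem_Icc.2 ha.le) (Set.right_mem_Icc.2 ha.le) ha.le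
  have e1 : a + κ * a - κ * 1 = a + κ * (a - 1) := by ring
  have e2 : a + κ * a - κ * a = a := by ring
  simp only [hI, e1, e2] at hfin
  exact hfin

end PowerMeans

/-! ### Hypercontractivity of the Gaussian kernel -/

section Hypercontractivity

variable {d : ℕ} {h : ℝ}

theorem lintegral_rpow_proxForward_rpow (hh : 0 < h) {K : ℝ} {X : EuclideanSpace ℝ (Fin d) → ℝ}
    (hX : Measurable X) (hK : ∀ y, |X y| ≤ K) {θ : ℝ} (hθ : 0 < θ) (s : ℝ)
    (x : EuclideanSpace ℝ (Fin d)) :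
    (∫⁻ y, ENNReal.ofReal (Real.exp (X y)) ^ θ ∂proxForward h x) ^ s
      = ENNReal.ofReal (Real.exp (s * θ * logPowerMean h X θ x)) := by
  have hpos := integral_exp_mul_pos hh hX hK θ x
  have h1 : ∀ y, ENNReal.ofReal (Real.exp (X y)) ^ θ
      = ENNReal.ofReal (Real.exp (θ * X y)) := by
    intro y
    rw [ENNReal.ofReal_rpow_of_pos (Real.exp_pos _), ← Real.exp_mul, mul_comm]
  simp_rw [h1]
  rw [← ofReal_integral_eq_lintegral_ofReal (integrable_exp_mul_of_bounded hh hX hK θ x)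
    (Filter.Eventually.of_forall fun y => (Real.exp_pos _).le),
    ENNReal.ofReal_rpow_of_pos hpos, Real.rpow_def_of_pos hpos, logPowerMean]
  congr 2
  field_simp

theorem ofReal_rpow_inv_le_of_log_div_le {s t a b : ℝ} (hs : 0 < s) (ht : 0 < t)
    (hst : Real.log s / b ≤ Real.log t / a) :
    ENNReal.ofReal s ^ (1 / b) ≤ ENNReal.ofReal t ^ (1 / a) := by
  rw [ENNReal.ofReal_rpow_of_pos hs, ENNReal.ofReal_rpow_of_pos ht, Real.rpow_def_of_pos hs,
    Real.rpow_def_of_pos ht, mul_one_div, mul_one_div]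
  exact ENNReal.ofReal_le_ofReal (Real.exp_le_exp.2 hst)

theorem lintegral_rpow_lintegral_proxForward_le_of_bounded
    {π : Measure (EuclideanSpace ℝ (Fin d))} [IsProbabilityMeasure π] (hh : 0 < h) {κ : ℝ}
    (hκ : 0 < κ) (hlsi : SatisfiesLSI π (h / κ)) {a : ℝ} (ha : 1 < a)
    {g : EuclideanSpace ℝ (Fin d) → ℝ≥0∞} (hg : Measurable g) {δ M : ℝ} (hδ : 0 < δ)
    (hδg : ∀ y, ENNReal.ofReal δ ≤ g y) (hgM : ∀ y, g y ≤ ENNReal.ofReal M) :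
    (∫⁻ x, (∫⁻ y, g y ∂proxForward h x) ^ (a + κ * (a - 1)) ∂π) ^ (1 / (a + κ * (a - 1)))
      ≤ (∫⁻ x, ∫⁻ y, g y ^ a ∂proxForward h x ∂π) ^ (1 / a) := by
  set X : EuclideanSpace ℝ (Fin d) → ℝ := fun y => Real.log (g y).toReal with hXdef
  have hX : Measurable X := by fun_prop
  have hM0 : 0 < M := by
    have := (ENNReal.ofReal_pos.2 hδ).trans_le ((hδg 0).trans (hgM 0))
    exact ENNReal.ofReal_pos.1 this
  have htop : ∀ y, g y ≠ ∞ := fun y => ((hgM y).trans_lt ENNReal.ofReal_lt_top).ne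
  have hlow : ∀ y, δ ≤ (g y).toReal := fun y => (ENNReal.ofReal_le_iff_le_toReal (htop y)).1 (hδg y)
  have hup : ∀ y, (g y).toReal ≤ M := fun y => ENNReal.toReal_le_of_le_ofReal hM0.le (hgM y)
  have hgX : ∀ y, g y = ENNReal.ofReal (Real.exp (X y)) := by
    intro y
    rw [hXdef, Real.exp_log (hδ.trans_le (hlow y)), ENNReal.ofReal_toReal (htop y)]
  have hK : ∀ y, |X y| ≤ max (-Real.log δ) (Real.log M) := by
    intro y
    have h1 := Real.log_le_log hδ (hlow y)
    have h2 := Real.log_le_log (hδ.trans_le (hlow y)) (hup y)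
    refine abs_le'.2 ⟨h2.trans (le_max_right _ _), le_trans ?_ (le_max_left _ _)⟩
    exact neg_le_neg h1
  have hbpos : 0 < a + κ * (a - 1) := by nlinarith
  have hint : ∀ θ, 0 < θ → ∀ b, Integrable (fun x => Real.exp (b * logPowerMean h X θ x)) π := by
    intro θ hθ b
    have := measurable_logPowerMean hh hX θ
    refine Integrable.of_bound (by fun_prop)
      (Real.exp (|b| * max (-Real.log δ) (Real.log M))) (Filter.Eventually.of_forall fun x => ?_)
    rw [Real.norm_eq_abs, Real.abs_exp]
    refine Real.exp_le_exp.2 ((le_abs_self _).trans ?_)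
    rw [abs_mul]
    exact mul_le_mul_of_nonneg_left (abs_logPowerMean_le hh hX hK hθ x) (abs_nonneg _)
  have e1 : ∀ x, (∫⁻ y, g y ∂proxForward h x) ^ (a + κ * (a - 1))
      = ENNReal.ofReal (Real.exp ((a + κ * (a - 1)) * logPowerMean h X 1 x)) := by
    intro x
    have := lintegral_rpow_proxForward_rpow hh hX hK one_pos (a + κ * (a - 1)) x
    simpa only [ENNReal.rpow_one, mul_one, ← hgX] using this
  have e2 : ∀ x, ∫⁻ y, g y ^ a ∂proxForward h x
      = ENNReal.ofReal (Real.exp (a * logPowerMean h X a x)) := by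
    intro x
    have := lintegral_rpow_proxForward_rpow hh hX hK (zero_lt_one.trans ha) 1 x
    simpa only [ENNReal.rpow_one, one_mul, ← hgX] using this
  simp_rw [e1, e2]
  rw [← ofReal_integral_eq_lintegral_ofReal (hint 1 one_pos _)
      (Filter.Eventually.of_forall fun y => (Real.exp_pos _).le),
    ← ofReal_integral_eq_lintegral_ofReal (hint a (zero_lt_one.trans ha) _)
      (Filter.Eventually.of_forall fun y => (Real.exp_pos _).le)]
  exact ofReal_rpow_inv_le_of_log_div_le (integral_exp_pos (hint 1 one_pos _))
    (integral_exp_pos (hint a (zero_lt_one.trans ha) _))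
    (log_integral_exp_logPowerMean_le hh hκ hlsi hX hK ha)

/-- Hypercontractivity of the Gaussian kernel from `L^a(π * γ_h)` to `L^b(π)`,
`b - 1 = (1 + κ) (a - 1)`, under a logarithmic Sobolev inequality with constant `h / κ`. -/
theorem lintegral_rpow_lintegral_proxForward_le
    {π : Measure (EuclideanSpace ℝ (Fin d))} [IsProbabilityMeasure π] (hh : 0 < h) {κ : ℝ}
    (hκ : 0 < κ) (hlsi : SatisfiesLSI π (h / κ)) {a : ℝ} (ha : 1 < a)
    {g : EuclideanSpace ℝ (Fin d) → ℝ≥0∞} (hg : Measurable g) :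
    (∫⁻ x, (∫⁻ y, g y ∂proxForward h x) ^ (a + κ * (a - 1)) ∂π) ^ (1 / (a + κ * (a - 1)))
      ≤ (∫⁻ y, g y ^ a ∂π.bind (proxForward h)) ^ (1 / a) := by
  have := isMarkovKernel_proxForward d hh
  have ha0 : 0 < a := zero_lt_one.trans ha
  have hbpos : 0 < a + κ * (a - 1) := by nlinarith
  have hbind : ∀ {g : EuclideanSpace ℝ (Fin d) → ℝ≥0∞}, Measurable g →
      ∫⁻ y, g y ^ a ∂π.bind (proxForward h) = ∫⁻ x, ∫⁻ y, g y ^ a ∂proxForward h x ∂π :=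
    fun hg => Measure.lintegral_bind (Kernel.aemeasurable _) (hg.pow_const a).aemeasurable
  -- `min g k` is bounded above but not away from `0`: add `δ`, paid for by Minkowski's inequality.
  have htrunc : ∀ k : ℕ,
      (∫⁻ x, (∫⁻ y, min (g y) k ∂proxForward h x) ^ (a + κ * (a - 1)) ∂π)
        ^ (1 / (a + κ * (a - 1))) ≤ (∫⁻ y, g y ^ a ∂π.bind (proxForward h)) ^ (1 / a) := by
    intro k
    refine ENNReal.le_of_forall_pos_le_add fun δ hδ _ => ?_
    have hgk : Measurable fun y => min (g y) k := hg.min measurable_const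
    have hgkδ : Measurable fun y => min (g y) k + (δ : ℝ≥0∞) := hgk.add_const _
    calc _ ≤ (∫⁻ x, (∫⁻ y, (min (g y) k + (δ : ℝ≥0∞)) ∂proxForward h x) ^ (a + κ * (a - 1)) ∂π)
        ^ (1 / (a + κ * (a - 1))) := by
          gcongr
          exact le_self_add
      _ ≤ (∫⁻ x, ∫⁻ y, (min (g y) k + (δ : ℝ≥0∞)) ^ a ∂proxForward h x ∂π) ^ (1 / a) := by
          refine lintegral_rpow_lintegral_proxForward_le_of_bounded hh hκ hlsi ha hgkδ
            (δ := δ) (M := k + δ) (by exact_mod_cast hδ) (fun y => ?_) (fun y => ?_)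
          · rw [ENNReal.ofReal_coe_nnreal]
            exact le_add_self
          · rw [ENNReal.ofReal_add (Nat.cast_nonneg _) δ.coe_nonneg, ENNReal.ofReal_natCast,
              ENNReal.ofReal_coe_nnreal]
            gcongr
            exact min_le_right _ _
      _ = (∫⁻ y, (min (g y) k + (δ : ℝ≥0∞)) ^ a ∂π.bind (proxForward h)) ^ (1 / a) := by
          rw [hbind hgkδ]
      _ ≤ (∫⁻ y, min (g y) k ^ a ∂π.bind (proxForward h)) ^ (1 / a)
          + (∫⁻ _, (δ : ℝ≥0∞) ^ a ∂π.bind (proxForward h)) ^ (1 / a) :=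
          ENNReal.lintegral_Lp_add_le hgk.aemeasurable aemeasurable_const ha.le
      _ ≤ (∫⁻ y, g y ^ a ∂π.bind (proxForward h)) ^ (1 / a) + δ := by
          gcongr
          · exact min_le_left _ _
          · rw [lintegral_const, measure_univ, mul_one, ← ENNReal.rpow_mul,
              mul_one_div_cancel ha0.ne', ENNReal.rpow_one]
  have hmonok : ∀ y, Monotone fun k : ℕ => min (g y) (k : ℝ≥0∞) := fun y i j hij =>
    min_le_min_left _ (Nat.cast_le.2 hij)
  have hmin : ∀ y, Filter.Tendsto (fun k : ℕ => min (g y) (k : ℝ≥0∞)) Filter.atTop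
      (nhds (g y)) := by
    intro y
    have := (tendsto_const_nhds (x := g y)).min ENNReal.tendsto_nat_nhds_top
    simpa using this
  have hinner : ∀ x, Filter.Tendsto
      (fun k : ℕ => (∫⁻ y, min (g y) k ∂proxForward h x) ^ (a + κ * (a - 1))) Filter.atTop
      (nhds ((∫⁻ y, g y ∂proxForward h x) ^ (a + κ * (a - 1)))) := fun x =>
    (ENNReal.continuous_rpow_const.tendsto _).comp
      (lintegral_tendsto_of_tendsto_of_monotone
        (fun k => (hg.min measurable_const).aemeasurable)
        (Filter.Eventually.of_forall hmonok) (Filter.Eventually.of_forall hmin))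
  have houter := lintegral_tendsto_of_tendsto_of_monotone (μ := π)
    (fun k : ℕ => ((Measurable.lintegral_kernel (κ := proxForward h)
      (hg.min (measurable_const (a := (k : ℝ≥0∞))))).pow_const (a + κ * (a - 1))).aemeasurable)
    (Filter.Eventually.of_forall fun x i j hij =>
      ENNReal.rpow_le_rpow (lintegral_mono fun y => hmonok y hij) hbpos.le)
    (Filter.Eventually.of_forall hinner)
  exact le_of_tendsto' ((ENNReal.continuous_rpow_const.tendsto _).comp houter) htrunc

end Hypercontractivity

/-! ### One iteration of the proximal sampler -/

noncomputable section Sampler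

variable {d : ℕ} {h : ℝ} {π : Measure (EuclideanSpace ℝ (Fin d))} [IsProbabilityMeasure π]

theorem measurable_proxNormalizer (h : ℝ) : Measurable (proxNormalizer π h) := by
  unfold proxNormalizer
  exact Measurable.lintegral_prod_right' (f := fun p : EuclideanSpace ℝ (Fin d) × _ =>
    gaussianDensity h (p.2 - p.1)) (by fun_prop)

theorem proxNormalizer_ne_zero (hh : 0 < h) (y : EuclideanSpace ℝ (Fin d)) :
    proxNormalizer π h y ≠ 0 := by
  unfold proxNormalizer
  rw [Ne, lintegral_eq_zero_iff (by fun_prop)]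
  intro h0
  have : ∀ᵐ _ : EuclideanSpace ℝ (Fin d) ∂π, False :=
    h0.mono fun x hx => (gaussianDensity_pos hh (x - y)).ne' hx
  exact IsProbabilityMeasure.ne_zero π (by simpa using this)

theorem proxNormalizer_ne_top (hh : 0 < h) (y : EuclideanSpace ℝ (Fin d)) :
    proxNormalizer π h y ≠ ∞ := by
  unfold proxNormalizer
  refine ((lintegral_mono fun x => gaussianDensity_le hh (x - y)).trans_lt ?_).ne
  simp

theorem proxBackward_apply (y : EuclideanSpace ℝ (Fin d)) :
    proxBackward π h y
      = π.withDensity (fun x => gaussianDensity h (x - y) / proxNormalizer π h y) := by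
  have := measurable_proxNormalizer (π := π) h
  unfold proxBackward
  rw [Kernel.withDensity_apply _ (by fun_prop), Kernel.const_apply]

theorem isMarkovKernel_proxBackward (hh : 0 < h) : IsMarkovKernel (proxBackward π h) := by
  refine ⟨fun y => ⟨?_⟩⟩
  rw [proxBackward_apply, withDensity_apply _ MeasurableSet.univ, Measure.restrict_univ]
  simp_rw [div_eq_mul_inv]
  rw [lintegral_mul_const _ (by fun_prop)]
  exact ENNReal.mul_inv_cancel (proxNormalizer_ne_zero hh y) (proxNormalizer_ne_top hh y)

/-- Bayes' rule for the forward step, with the density of the law of `y` relative to Lebesgue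
measure. -/
theorem withDensity_bind_proxForward (hh : 0 < h) {f : EuclideanSpace ℝ (Fin d) → ℝ≥0∞}
    (hf : Measurable f) :
    (π.withDensity f).bind (proxForward h) = volume.withDensity
      (fun y => proxNormalizer π h y * ∫⁻ x, f x ∂proxBackward π h y) := by
  have hF := isMarkovKernel_proxForward d hh
  have hZ := measurable_proxNormalizer (π := π) h
  ext A hA
  rw [Measure.bind_apply hA (Kernel.aemeasurable _), withDensity_apply _ hA,
    lintegral_withDensity_eq_lintegral_mul _ hf (Kernel.measurable_coe _ hA)]
  have e1 : ∀ x, (f * fun x => proxForward h x A) x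
      = ∫⁻ y in A, f x * gaussianDensity h (y - x) := by
    intro x
    rw [Pi.mul_apply, proxForward_apply, withDensity_apply _ hA,
      lintegral_const_mul _ (by fun_prop)]
  have e2 : ∀ y, proxNormalizer π h y * ∫⁻ x, f x ∂proxBackward π h y
      = ∫⁻ x, f x * gaussianDensity h (y - x) ∂π := by
    intro y
    rw [proxBackward_apply, lintegral_withDensity_eq_lintegral_mul _ (by fun_prop) hf,
      ← lintegral_const_mul _ (by fun_prop)]
    congr 1
    ext x
    rw [Pi.mul_apply, ← mul_assoc,
      ENNReal.mul_div_cancel (proxNormalizer_ne_zero hh y) (proxNormalizer_ne_top hh y),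
      gaussianDensity_sub_comm, mul_comm]
  simp_rw [e1, e2]
  exact lintegral_lintegral_swap (by fun_prop)

theorem bind_proxForward (hh : 0 < h) :
    π.bind (proxForward h) = volume.withDensity (proxNormalizer π h) := by
  have := isMarkovKernel_proxBackward (π := π) hh
  have h1 := withDensity_bind_proxForward (π := π) hh (f := 1) measurable_one
  simpa using h1

theorem withDensity_bind_proxBackward (hh : 0 < h) {g : EuclideanSpace ℝ (Fin d) → ℝ≥0∞}
    (hg : Measurable g) :
    (volume.withDensity (fun y => proxNormalizer π h y * g y)).bind (proxBackward π h)
      = π.withDensity (fun x => ∫⁻ y, g y ∂proxForward h x) := by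
  have hB := isMarkovKernel_proxBackward (π := π) hh
  have hZ := measurable_proxNormalizer (π := π) h
  ext A hA
  rw [Measure.bind_apply hA (Kernel.aemeasurable _), withDensity_apply _ hA,
    lintegral_withDensity_eq_lintegral_mul _ (by fun_prop) (Kernel.measurable_coe _ hA)]
  have e1 : ∀ y, ((fun y => proxNormalizer π h y * g y) * fun y => proxBackward π h y A) y
      = ∫⁻ x in A, gaussianDensity h (y - x) * g y ∂π := by
    intro y
    rw [Pi.mul_apply, proxBackward_apply, withDensity_apply _ hA,
      ← lintegral_const_mul _ (by fun_prop)]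
    congr 1
    ext x
    rw [mul_right_comm, ENNReal.mul_div_cancel (proxNormalizer_ne_zero hh y)
      (proxNormalizer_ne_top hh y), gaussianDensity_sub_comm]
  simp_rw [e1, lintegral_proxForward h _ hg]
  exact lintegral_lintegral_swap (by fun_prop)

/-- Density, relative to `π`, of the law of one proximal iteration started at `f π`. -/
def proxStepDensity (π : Measure (EuclideanSpace ℝ (Fin d))) [SFinite π] (h : ℝ)
    (f : EuclideanSpace ℝ (Fin d) → ℝ≥0∞) (x : EuclideanSpace ℝ (Fin d)) : ℝ≥0∞ :=
  ∫⁻ y, ∫⁻ z, f z ∂proxBackward π h y ∂proxForward h x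

theorem withDensity_bind_bind (hh : 0 < h) {f : EuclideanSpace ℝ (Fin d) → ℝ≥0∞}
    (hf : Measurable f) :
    ((π.withDensity f).bind (proxForward h)).bind (proxBackward π h)
      = π.withDensity (proxStepDensity π h f) := by
  rw [withDensity_bind_proxForward hh hf, withDensity_bind_proxBackward hh hf.lintegral_kernel]
  rfl

theorem bind_proxForward_bind_proxBackward (hh : 0 < h) :
    (π.bind (proxForward h)).bind (proxBackward π h) = π := by
  have := isMarkovKernel_proxForward d hh
  have h1 := withDensity_bind_proxBackward (π := π) hh (g := 1) measurable_one
  rw [bind_proxForward hh]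
  simpa using h1

theorem measurable_proxStepDensity {f : EuclideanSpace ℝ (Fin d) → ℝ≥0∞}
    (hf : Measurable f) : Measurable (proxStepDensity π h f) :=
  (hf.lintegral_kernel (κ := proxBackward π h)).lintegral_kernel (κ := proxForward h)

theorem lintegral_rpow_mono_exponent {α : Type*} [MeasurableSpace α] (μ : Measure α)
    [IsProbabilityMeasure μ] {f : α → ℝ≥0∞} (hf : Measurable f) {p q : ℝ} (hp : 0 < p)
    (hpq : p ≤ q) :
    (∫⁻ x, f x ^ p ∂μ) ^ (1 / p) ≤ (∫⁻ x, f x ^ q ∂μ) ^ (1 / q) := by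
  have h1 := eLpNorm'_le_eLpNorm'_of_exponent_le hp hpq μ hf.aestronglyMeasurable
  simpa only [eLpNorm', enorm_eq_self] using h1

theorem lintegral_rpow_le {α : Type*} [MeasurableSpace α] (μ : Measure α)
    [IsProbabilityMeasure μ] {f : α → ℝ≥0∞} (hf : Measurable f) {a : ℝ} (ha : 1 ≤ a) :
    (∫⁻ x, f x ∂μ) ^ a ≤ ∫⁻ x, f x ^ a ∂μ := by
  have ha0 : 0 < a := zero_lt_one.trans_le ha
  have h1 := ENNReal.rpow_le_rpow (lintegral_rpow_mono_exponent μ hf one_pos ha) ha0.le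
  simpa only [ENNReal.rpow_one, one_div, inv_one, ENNReal.rpow_inv_rpow ha0.ne'] using h1

/-- One proximal iteration improves integrability of densities: it maps `L^a(π)` to `L^b(π)` with
norm at most one, where `b - 1 = (1 + κ) (a - 1)`. The posterior averaging contracts by Jensen, and
the gain comes from the Gaussian averaging. -/
theorem lintegral_proxStepDensity_rpow_le (hh : 0 < h) {κ : ℝ} (hκ : 0 < κ)
    (hlsi : SatisfiesLSI π (h / κ)) {a : ℝ} (ha : 1 < a)
    {f : EuclideanSpace ℝ (Fin d) → ℝ≥0∞} (hf : Measurable f) :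
    (∫⁻ x, proxStepDensity π h f x ^ (a + κ * (a - 1)) ∂π) ^ (1 / (a + κ * (a - 1)))
      ≤ (∫⁻ x, f x ^ a ∂π) ^ (1 / a) := by
  have hB := isMarkovKernel_proxBackward (π := π) hh
  refine (lintegral_rpow_lintegral_proxForward_le hh hκ hlsi ha
    (hf.lintegral_kernel (κ := proxBackward π h))).trans ?_
  refine ENNReal.rpow_le_rpow ?_ (by positivity)
  calc _ ≤ ∫⁻ y, ∫⁻ x, f x ^ a ∂proxBackward π h y ∂π.bind (proxForward h) :=
        lintegral_mono fun y => lintegral_rpow_le _ hf ha.le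
    _ = ∫⁻ x, f x ^ a ∂(π.bind (proxForward h)).bind (proxBackward π h) :=
        (Measure.lintegral_bind (Kernel.aemeasurable _) (hf.pow_const a).aemeasurable).symm
    _ = _ := by rw [bind_proxForward_bind_proxBackward hh]

end Sampler

/-! ### Rényi divergence -/

section Renyi

variable {α : Type*} [MeasurableSpace α]

theorem renyiDiv_withDensity (q : ℝ) (π : Measure α) [SigmaFinite π] {f : α → ℝ≥0∞}
    (hf : Measurable f) : renyiDiv q (π.withDensity f) π
      = (((q - 1)⁻¹ : ℝ) : EReal) * ENNReal.log (∫⁻ x, f x ^ q ∂π) := by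
  rw [renyiDiv, if_pos (withDensity_absolutelyContinuous π f)]
  congr 2
  refine lintegral_congr_ae ?_
  filter_upwards [Measure.rnDeriv_withDensity π hf] with x hx
  rw [hx]

theorem coe_inv_mul_log_eq {q : ℝ} (hq : 1 < q) (I : ℝ≥0∞) :
    (((q - 1)⁻¹ : ℝ) : EReal) * ENNReal.log I
      = ((q / (q - 1) : ℝ) : EReal) * ENNReal.log (I ^ (1 / q)) := by
  rw [ENNReal.log_rpow, ← mul_assoc, ← EReal.coe_mul]
  congr 2
  field_simp

theorem renyiDiv_nonneg {q : ℝ} (hq : 1 < q) (μ π : Measure α) [IsProbabilityMeasure μ]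
    [IsProbabilityMeasure π] : 0 ≤ renyiDiv q μ π := by
  unfold renyiDiv
  split_ifs with hac
  · refine mul_nonneg (EReal.coe_nonneg.2 (inv_nonneg.2 (by linarith))) ?_
    have h1 := lintegral_rpow_le π (Measure.measurable_rnDeriv μ π) hq.le
    rw [Measure.lintegral_rnDeriv hac, measure_univ, ENNReal.one_rpow] at h1
    rw [← ENNReal.log_one]
    exact ENNReal.log_le_log h1
  · exact le_top

/-- Rényi divergences increase with the order: `R_q` is the logarithm of the `L^{q-1}(μ)` norm of
the density `dμ/dπ`. -/
theorem renyiDiv_mono_order {p q : ℝ} (hp : 1 < p) (hpq : p ≤ q) (μ π : Measure α)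
    [IsProbabilityMeasure μ] [IsProbabilityMeasure π] : renyiDiv p μ π ≤ renyiDiv q μ π := by
  unfold renyiDiv
  split_ifs with hac
  · set f := μ.rnDeriv π with hf
    have hfm : Measurable f := Measure.measurable_rnDeriv μ π
    have hμ : π.withDensity f = μ := Measure.withDensity_rnDeriv_eq μ π hac
    have e1 : ∀ r : ℝ, 1 < r → ∫⁻ x, f x ^ r ∂π = ∫⁻ x, f x ^ (r - 1) ∂μ := by
      intro r hr
      conv_rhs => rw [← hμ]
      rw [lintegral_withDensity_eq_lintegral_mul _ hfm (hfm.pow_const _)]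
      congr 1
      ext x
      rw [Pi.mul_apply]
      conv_rhs => rw [← ENNReal.rpow_one (f x)]
      rw [← ENNReal.rpow_mul, one_mul,
        ← ENNReal.rpow_add_of_nonneg 1 (r - 1) zero_le_one (by linarith)]
      congr 1
      ring
    rw [e1 p hp, e1 q (hp.trans_le hpq), ← ENNReal.log_rpow, ← ENNReal.log_rpow]
    refine ENNReal.log_le_log ?_
    have := lintegral_rpow_mono_exponent μ hfm (sub_pos.2 hp) (sub_le_sub_right hpq 1)
    simpa only [one_div] using this
  · exact le_rfl

end Renyi

/-! ### The logarithmic Sobolev constant -/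

section LogSobolevConst

variable {d : ℕ} {π : Measure (EuclideanSpace ℝ (Fin d))}

theorem SatisfiesLSI.mono {C C' : ℝ} (hC : SatisfiesLSI π C) (hCC' : C ≤ C') :
    SatisfiesLSI π C' := by
  intro f hf hf2 hfd
  obtain ⟨h1, h2⟩ := hC f hf hf2 hfd
  refine ⟨h1, h2.trans ?_⟩
  have : 0 ≤ ∫ x, ‖fderiv ℝ f x‖ ^ 2 ∂π := integral_nonneg fun x => sq_nonneg _
  gcongr

/-- The infimum defining the logarithmic Sobolev constant is attained. -/
theorem satisfiesLSI_logSobolevConst (hC : ∃ C : ℝ, 0 ≤ C ∧ SatisfiesLSI π C) :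
    SatisfiesLSI π (logSobolevConst π) := by
  obtain ⟨C₀, hC₀⟩ := hC
  intro f hf hf2 hfd
  obtain ⟨h1, -⟩ := hC₀.2 f hf hf2 hfd
  refine ⟨h1, ?_⟩
  set E := ∫ x, ‖fderiv ℝ f x‖ ^ 2 ∂π with hE
  have hE0 : 0 ≤ E := integral_nonneg fun x => sq_nonneg _
  refine le_of_forall_pos_le_add fun η hη => ?_
  obtain ⟨C, hC, hlt⟩ := exists_lt_of_csInf_lt (s := {C : ℝ | 0 ≤ C ∧ SatisfiesLSI π C})
    ⟨C₀, hC₀⟩ (show logSobolevConst π < logSobolevConst π + η / (2 * (E + 1)) by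
      have : 0 < η / (2 * (E + 1)) := by positivity
      linarith)
  refine (hC.2 f hf hf2 hfd).2.trans ?_
  rw [← hE]
  have h3 : 2 * C * E ≤ 2 * (logSobolevConst π + η / (2 * (E + 1))) * E := by gcongr
  have h4 : 2 * (η / (2 * (E + 1))) * E ≤ η := by
    rw [show 2 * (η / (2 * (E + 1))) * E = η * E / (E + 1) by field_simp,
      div_le_iff₀ (by positivity)]
    nlinarith
  linarith

end LogSobolevConst

/-! ### Rényi divergence along the proximal sampler -/

section Convergence

variable {d : ℕ} {h : ℝ} {π : Measure (EuclideanSpace ℝ (Fin d))} [IsProbabilityMeasure π]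

theorem isProbabilityMeasure_proxLaw (hh : 0 < h) (π₀ : Measure (EuclideanSpace ℝ (Fin d)))
    [IsProbabilityMeasure π₀] (n : ℕ) : IsProbabilityMeasure (proxLaw π h π₀ n) := by
  have hF := isMarkovKernel_proxForward d hh
  have hB := isMarkovKernel_proxBackward (π := π) hh
  induction n with
  | zero => assumption
  | succ n ih =>
    unfold proxLaw
    infer_instance

/-- One proximal iteration multiplies `q - 1` by `1 + κ`; the ratio of the prefactors `q / (q - 1)`
that turn `L^q` norms into Rényi divergences is a genuine contraction. -/
theorem renyiDiv_proxStep_le (hh : 0 < h) {κ : ℝ} (hκ : 0 < κ) (hlsi : SatisfiesLSI π (h / κ))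
    (μ : Measure (EuclideanSpace ℝ (Fin d))) [IsProbabilityMeasure μ] {s : ℝ} (hs : 0 < s) :
    renyiDiv (1 + s * (1 + κ)) ((μ.bind (proxForward h)).bind (proxBackward π h)) π
      ≤ (((1 + s * (1 + κ)) / ((1 + s) * (1 + κ)) : ℝ) : EReal) * renyiDiv (1 + s) μ π := by
  by_cases hac : μ ≪ π
  swap
  · rw [renyiDiv, renyiDiv, if_neg hac, EReal.coe_mul_top_of_pos (by positivity)]
    exact le_top
  have hfm : Measurable (μ.rnDeriv π) := Measure.measurable_rnDeriv μ π
  have hb : (1 : ℝ) < 1 + s * (1 + κ) := by nlinarith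
  have := Measure.haveLebesgueDecomposition_of_sigmaFinite μ π
  have hstep := withDensity_bind_bind (π := π) hh hfm
  rw [Measure.withDensity_rnDeriv_eq μ π hac] at hstep
  rw [hstep, renyiDiv_withDensity _ _ (measurable_proxStepDensity hfm), renyiDiv, if_pos hac,
    coe_inv_mul_log_eq hb, coe_inv_mul_log_eq (by linarith : (1 : ℝ) < 1 + s), ← mul_assoc,
    ← EReal.coe_mul]
  have key := lintegral_proxStepDensity_rpow_le hh hκ hlsi (by linarith : (1 : ℝ) < 1 + s) hfm
  have e1 : 1 + s + κ * (1 + s - 1) = 1 + s * (1 + κ) := by ring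
  rw [e1] at key
  have e2 : (1 + s * (1 + κ)) / ((1 + s) * (1 + κ)) * ((1 + s) / (1 + s - 1))
      = (1 + s * (1 + κ)) / (1 + s * (1 + κ) - 1) := by
    rw [add_sub_cancel_left, add_sub_cancel_left]
    field_simp
  rw [e2]
  exact mul_le_mul_of_nonneg_left (ENNReal.log_le_log key)
    (EReal.coe_nonneg.2 (div_nonneg (by positivity) (by linarith)))

theorem proxLaw_add (π₀ : Measure (EuclideanSpace ℝ (Fin d))) (m n : ℕ) :
    proxLaw π h π₀ (m + n) = proxLaw π h (proxLaw π h π₀ m) n := by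
  induction n with
  | zero => rfl
  | succ n ih => rw [← add_assoc, proxLaw, proxLaw, ih]

theorem renyiDiv_proxLaw_le (hh : 0 < h) {κ : ℝ} (hκ : 0 < κ) (hlsi : SatisfiesLSI π (h / κ))
    (π₀ : Measure (EuclideanSpace ℝ (Fin d))) [IsProbabilityMeasure π₀] {s : ℝ} (hs : 0 < s)
    (n : ℕ) :
    renyiDiv (1 + s * (1 + κ) ^ n) (proxLaw π h π₀ n) π ≤ renyiDiv (1 + s) π₀ π := by
  induction n with
  | zero => simp [proxLaw]
  | succ n ih =>
    have := isProbabilityMeasure_proxLaw (π := π) hh π₀ n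
    refine le_trans ?_ ih
    have hsn : 0 < s * (1 + κ) ^ n := by positivity
    have h1 := renyiDiv_proxStep_le hh hκ hlsi (proxLaw π h π₀ n) hsn
    rw [pow_succ, ← mul_assoc, proxLaw]
    refine h1.trans ?_
    have h2 := renyiDiv_nonneg (by linarith : 1 < 1 + s * (1 + κ) ^ n) (proxLaw π h π₀ n) π
    calc _ ≤ ((1 : ℝ) : EReal) * renyiDiv (1 + s * (1 + κ) ^ n) (proxLaw π h π₀ n) π := by
          refine mul_le_mul_of_nonneg_right (EReal.coe_le_coe_iff.2 ?_) h2
          rw [div_le_one (by positivity)]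
          nlinarith
      _ = _ := by rw [EReal.coe_one, one_mul]

/-- At orders at most `2`, the divergence decays geometrically while the order keeps growing up
to `2`. -/
theorem renyiDiv_proxLaw_le_geometric (hh : 0 < h) {κ : ℝ} (hκ : 0 < κ) (hκ1 : κ ≤ 1)
    (hlsi : SatisfiesLSI π (h / κ)) (π₀ : Measure (EuclideanSpace ℝ (Fin d)))
    [IsProbabilityMeasure π₀] {s : ℝ} (hs : 0 < s) (hs1 : s ≤ 1) (n : ℕ) :
    renyiDiv (1 + min 1 (s * (1 + κ) ^ n)) (proxLaw π h π₀ n) π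
      ≤ (((1 - κ / 4) ^ n : ℝ) : EReal) * renyiDiv (1 + s) π₀ π := by
  induction n with
  | zero => simp [proxLaw, min_eq_right hs1]
  | succ n ih =>
    have := isProbabilityMeasure_proxLaw (π := π) hh π₀ n
    have hprob := isProbabilityMeasure_proxLaw (π := π) hh π₀ (n + 1)
    set t := min 1 (s * (1 + κ) ^ n) with ht
    have ht0 : 0 < t := lt_min one_pos (by positivity)
    have ht1 : t ≤ 1 := min_le_left _ _
    have hord : min 1 (s * (1 + κ) ^ (n + 1)) ≤ t * (1 + κ) := by
      rcases min_choice 1 (s * (1 + κ) ^ n) with h1 | h1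
      · rw [ht, h1]
        exact (min_le_left _ _).trans (by linarith)
      · rw [ht, h1, pow_succ, ← mul_assoc]
        exact min_le_right _ _
    have hpos : 0 < min 1 (s * (1 + κ) ^ (n + 1)) := lt_min one_pos (by positivity)
    have h2 := renyiDiv_nonneg (by linarith : 1 < 1 + t) (proxLaw π h π₀ n) π
    calc _ ≤ renyiDiv (1 + t * (1 + κ)) (proxLaw π h π₀ (n + 1)) π :=
          renyiDiv_mono_order (by linarith) (by linarith) _ _
      _ ≤ (((1 + t * (1 + κ)) / ((1 + t) * (1 + κ)) : ℝ) : EReal)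
            * renyiDiv (1 + t) (proxLaw π h π₀ n) π :=
          renyiDiv_proxStep_le hh hκ hlsi _ ht0
      _ ≤ ((1 - κ / 4 : ℝ) : EReal) * renyiDiv (1 + t) (proxLaw π h π₀ n) π := by
          refine mul_le_mul_of_nonneg_right (EReal.coe_le_coe_iff.2 ?_) h2
          rw [div_le_iff₀ (by positivity)]
          have e3 : (1 + t) * (1 + κ) ≤ 4 := by nlinarith
          nlinarith
      _ ≤ ((1 - κ / 4 : ℝ) : EReal) *
            ((((1 - κ / 4) ^ n : ℝ) : EReal) * renyiDiv (1 + s) π₀ π) :=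
          mul_le_mul_of_nonneg_left ih (EReal.coe_nonneg.2 (by linarith))
      _ = _ := by rw [← mul_assoc, ← EReal.coe_mul, pow_succ, mul_comm (1 - κ / 4)]

theorem le_one_add_pow_of_log_le {κ r : ℝ} (hκ : 0 < κ) (hκ1 : κ ≤ 1) (hr : 0 < r) {n : ℕ}
    (hn : 2 * κ⁻¹ * Real.log r ≤ n) : r ≤ (1 + κ) ^ n := by
  rw [← Real.log_le_log_iff hr (by positivity), Real.log_pow]
  have h1 : κ / 2 ≤ Real.log (1 + κ) := by
    refine le_trans ?_ (Real.one_sub_inv_le_log_of_pos (by linarith))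
    rw [show 1 - (1 + κ)⁻¹ = κ / (1 + κ) by field_simp; ring]
    gcongr
    linarith
  calc Real.log r = 2 * κ⁻¹ * Real.log r * (κ / 2) := by field_simp
    _ ≤ n * (κ / 2) := by gcongr
    _ ≤ n * Real.log (1 + κ) := by gcongr

theorem one_sub_pow_le_of_log_le {κ r : ℝ} (hκ1 : κ ≤ 1) (hκ : 0 < κ) (hr : 0 < r) {n : ℕ}
    (hn : 4 * κ⁻¹ * Real.log r ≤ n) : (1 - κ / 4) ^ n ≤ r⁻¹ := by
  calc (1 - κ / 4) ^ n ≤ Real.exp (-(κ / 4)) ^ n := by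
        gcongr
        · linarith
        · exact Real.one_sub_le_exp_neg _
    _ = Real.exp (-(n * (κ / 4))) := by rw [← Real.exp_nat_mul]; ring_nf
    _ ≤ Real.exp (-Real.log r) := by
        refine Real.exp_le_exp.2 (neg_le_neg ?_)
        calc Real.log r = 4 * κ⁻¹ * Real.log r * (κ / 4) := by field_simp
          _ ≤ n * (κ / 4) := by gcongr
    _ = r⁻¹ := by rw [Real.exp_neg, Real.exp_log hr]

theorem renyiDiv_proxLaw_le_of_log_le (hh : 0 < h) {κ : ℝ} (hκ : 0 < κ) (hκ1 : κ ≤ 1)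
    (hlsi : SatisfiesLSI π (h / κ)) (π₀ : Measure (EuclideanSpace ℝ (Fin d)))
    [IsProbabilityMeasure π₀] {p q : ℝ} (hp : 1 < p) (hq : 1 < q) {n : ℕ}
    (hn : 2 * κ⁻¹ * Real.log ((q - 1) / (p - 1)) ≤ n) :
    renyiDiv q (proxLaw π h π₀ n) π ≤ renyiDiv p π₀ π := by
  have := isProbabilityMeasure_proxLaw (π := π) hh π₀ n
  have hp0 : 0 < p - 1 := by linarith
  have h1 := le_one_add_pow_of_log_le hκ hκ1 (div_pos (sub_pos.2 hq) hp0) hn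
  rw [div_le_iff₀ hp0, mul_comm] at h1
  have h2 := renyiDiv_proxLaw_le hh hκ hlsi π₀ hp0 n
  rw [add_sub_cancel] at h2
  exact (renyiDiv_mono_order hq (by linarith) _ _).trans h2

/-- After `4 κ⁻¹ log (max 1 (R / ε) / (p - 1))` iterations, `R` being the initial divergence of
order `p`, the divergence of every order `q ≤ 2` is at most `ε`. Growth of the order and decay of
the divergence happen during the same iterations. -/
theorem renyiDiv_proxLaw_le_eps (hh : 0 < h) {κ : ℝ} (hκ : 0 < κ) (hκ1 : κ ≤ 1)
    (hlsi : SatisfiesLSI π (h / κ)) (π₀ : Measure (EuclideanSpace ℝ (Fin d)))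
    [IsProbabilityMeasure π₀] {p q ε : ℝ} (hp : 1 < p) (hp2 : p ≤ 2) (hq : 1 < q) (hq2 : q ≤ 2)
    (hε : 0 < ε) (hfin : renyiDiv p π₀ π ≠ ⊤) {n : ℕ}
    (hn : 4 * κ⁻¹ * Real.log (max 1 ((renyiDiv p π₀ π).toReal / ε) / (p - 1)) ≤ n) :
    renyiDiv q (proxLaw π h π₀ n) π ≤ (ε : EReal) := by
  have := isProbabilityMeasure_proxLaw (π := π) hh π₀ n
  have hp0 : 0 < p - 1 := by linarith
  have hR := renyiDiv_nonneg hp π₀ π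
  have hcoe : ((renyiDiv p π₀ π).toReal : EReal) = renyiDiv p π₀ π :=
    EReal.coe_toReal hfin (fun hbot => by rw [hbot] at hR; simp at hR)
  have hgeo := renyiDiv_proxLaw_le_geometric hh hκ hκ1 hlsi π₀ hp0 (by linarith) n
  rw [add_sub_cancel, ← hcoe, ← EReal.coe_mul] at hgeo
  have hR0 : 0 ≤ (renyiDiv p π₀ π).toReal := EReal.toReal_nonneg hR
  set R := (renyiDiv p π₀ π).toReal with hRdef
  set A := max 1 (R / ε) with hA
  have hA1 : 1 ≤ A := le_max_left _ _
  have hAR : R ≤ A * ε := (div_le_iff₀ hε).1 (le_max_right _ _)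
  have hA0 : 0 < A := by linarith
  have hratio : 1 ≤ A / (p - 1) := by
    rw [one_le_div hp0]; linarith
  have hlog0 : 0 ≤ Real.log (A / (p - 1)) := Real.log_nonneg hratio
  have hord : q - 1 ≤ min 1 ((p - 1) * (1 + κ) ^ n) := by
    refine le_min (by linarith) ?_
    have h1 : A / (p - 1) ≤ (1 + κ) ^ n := by
      refine le_one_add_pow_of_log_le hκ hκ1 (div_pos hA0 hp0) (le_trans ?_ hn)
      gcongr
      norm_num
    rw [div_le_iff₀ hp0] at h1
    linarith
  refine (renyiDiv_mono_order hq (by linarith) _ _).trans (hgeo.trans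
    (EReal.coe_le_coe_iff.2 ?_))
  have h2 := one_sub_pow_le_of_log_le hκ1 hκ (div_pos hA0 hp0) hn
  calc (1 - κ / 4) ^ n * R ≤ (A / (p - 1))⁻¹ * R := by gcongr
    _ ≤ (A / (p - 1))⁻¹ * (A * ε) := by gcongr
    _ = (p - 1) * ε := by field_simp
    _ ≤ ε := by nlinarith

end Convergence

theorem corollary3 :
    ∃ c : ℝ, 0 < c ∧
      ∀ (d : ℕ) (π π₀ : Measure (EuclideanSpace ℝ (Fin d)))
        [IsProbabilityMeasure π] [IsProbabilityMeasure π₀] (h : ℝ),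
        π ≪ volume → (∃ C : ℝ, 0 ≤ C ∧ SatisfiesLSI π C) → 0 < h →
          (∀ p q : ℝ, 1 < p → p < q →
            ∃ N : ℕ,
              N ≤ ⌈c * max 1 (h⁻¹ * logSobolevConst π) * Real.logb 2 ((q - 1) / (p - 1))⌉₊ ∧
              ∀ n : ℕ, N ≤ n →
                renyiDiv q (proxLaw π h π₀ n) π ≤ renyiDiv p π₀ π) ∧
          (∀ ε q₀ q : ℝ, 0 < ε → 1 < q₀ → 1 < q →
            renyiDiv (min 2 q₀) π₀ π ≠ ⊤ →
            ∃ N : ℕ,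
              N ≤ ⌈c * max 1 (h⁻¹ * logSobolevConst π) *
                Real.log (q * max 1 ((renyiDiv (min 2 q₀) π₀ π).toReal / ε)
                  / (min 2 q₀ - 1))⌉₊ ∧
              ∀ n : ℕ, N ≤ n →
                renyiDiv q (proxLaw π h π₀ n) π ≤ (ε : EReal)) := by
  refine ⟨4, by norm_num, fun d π π₀ _ _ h _ hLSI hh => ?_⟩
  set T := max 1 (h⁻¹ * logSobolevConst π) with hT
  have hT1 : 1 ≤ T := le_max_left _ _
  have hT0 : 0 < T := by linarith
  have hκ : 0 < T⁻¹ := inv_pos.2 hT0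
  have hκ1 : T⁻¹ ≤ 1 := inv_le_one_of_one_le₀ hT1
  have hlsi : SatisfiesLSI π (h / T⁻¹) := by
    refine (satisfiesLSI_logSobolevConst hLSI).mono ?_
    have h1 : h⁻¹ * logSobolevConst π ≤ T := le_max_right _ _
    rw [inv_mul_le_iff₀ hh] at h1
    rwa [div_inv_eq_mul]
  constructor
  · intro p q hp hpq
    refine ⟨_, le_rfl, fun n hn => ?_⟩
    refine renyiDiv_proxLaw_le_of_log_le hh hκ hκ1 hlsi π₀ hp (hp.trans hpq) ?_
    refine le_trans ?_ (Nat.ceil_le.1 hn)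
    have hlog : 0 ≤ Real.log ((q - 1) / (p - 1)) :=
      Real.log_nonneg ((one_le_div (by linarith)).2 (by linarith))
    have hlog2 : Real.log ((q - 1) / (p - 1)) ≤ Real.logb 2 ((q - 1) / (p - 1)) := by
      rw [Real.logb, le_div_iff₀ (Real.log_pos one_lt_two)]
      nlinarith [Real.log_two_lt_d9]
    rw [inv_inv]
    calc 2 * T * Real.log ((q - 1) / (p - 1)) ≤ 4 * T * Real.log ((q - 1) / (p - 1)) := by
          gcongr
          norm_num
      _ ≤ _ := by gcongr
  · intro ε q₀ q hε hq₀ hq hfin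
    set p := min 2 q₀ with hp
    have hp1 : 1 < p := lt_min one_lt_two hq₀
    have hp2 : p ≤ 2 := min_le_left _ _
    refine ⟨_, le_rfl, fun n hn => ?_⟩
    replace hn := Nat.ceil_le.1 hn
    set A := max 1 ((renyiDiv p π₀ π).toReal / ε) with hA
    have hA1 : 1 ≤ A := le_max_left _ _
    have hp0 : 0 < p - 1 := by linarith
    have hratio : 1 ≤ A / (p - 1) := by
      rw [one_le_div hp0]; linarith
    have hlog0 : 0 ≤ Real.log (A / (p - 1)) := Real.log_nonneg hratio
    have hlogq : 0 ≤ Real.log q := Real.log_nonneg hq.le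
    rw [mul_div_assoc, Real.log_mul (by linarith) (by positivity)] at hn
    rcases le_or_gt q 2 with hq2 | hq2
    · refine renyiDiv_proxLaw_le_eps hh hκ hκ1 hlsi π₀ hp1 hp2 hq hq2 hε hfin ?_
      rw [inv_inv]
      refine le_trans ?_ hn
      gcongr
      linarith
    · -- Spend the first `m` steps on order `2`, and the remaining ones on raising the order to `q`.
      set m := ⌈4 * T * Real.log (A / (p - 1))⌉₊ with hm
      have hm1 : 4 * T * Real.log (A / (p - 1)) ≤ m := Nat.le_ceil _
      have hm2 : (m : ℝ) < 4 * T * Real.log (A / (p - 1)) + 1 :=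
        Nat.ceil_lt_add_one (by positivity)
      have hlogq2 : 1 / 2 ≤ Real.log q := by
        have := Real.log_le_log two_pos hq2.le
        linarith [Real.log_two_gt_d9]
      -- Rounding `m` up costs at most one step, and `1 ≤ 2 T log q` because `q > 2`.
      have hround : 1 ≤ 2 * T * Real.log q := by nlinarith
      have hrest : (m : ℝ) + 2 * T * Real.log q ≤ n := by linarith
      have hmn : m ≤ n := by
        have : (m : ℝ) ≤ n := by linarith
        exact_mod_cast this
      have := isProbabilityMeasure_proxLaw (π := π) hh π₀ m
      obtain ⟨k, rfl⟩ := Nat.exists_eq_add_of_le hmn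
      rw [proxLaw_add]
      refine (renyiDiv_proxLaw_le_of_log_le hh hκ hκ1 hlsi _ one_lt_two hq ?_).trans
        (renyiDiv_proxLaw_le_eps hh hκ hκ1 hlsi π₀ hp1 hp2 one_lt_two le_rfl hε hfin
          (by rwa [inv_inv]))
      rw [inv_inv]
      push_cast at hrest
      have hle : Real.log ((q - 1) / (2 - 1)) ≤ Real.log q :=
        Real.log_le_log (by norm_num; linarith) (by norm_num)
      calc 2 * T * Real.log ((q - 1) / (2 - 1)) ≤ 2 * T * Real.log q := by gcongr
        _ ≤ k := by linarith
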